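/- Let $M$ be a (Hausdorff) smooth $n$-manifold and let $\mathcal E=T^*\Pi TM$, where $\Pi TM$ is the supermanifold with function algebra $\Omega^\bullet(M)$. Each chart $(x^i)$ of $M$ induces Darboux coordinates $(x^i,\xi^i,p_i,\theta_i)$ on $\mathcal E$, with $\xi^i,\theta_i$ odd and $x^i,p_i$ even, of bidegrees $x:(0,0)$, $\xi:(0,1)$, $\theta:(1,0)$, $p:(1,1)$. Functions on $\mathcal E$ are smooth in $x$ and polynomial in the other coordinates, and the canonical Poisson bracket is determined by $\{p_i,x^j\}=\delta_i^j=-\{x^j,p_i\}$ and $\{\xi^j,\theta_i\}=\delta_i^j=\{\theta_i,\xi^j\}$, the other brackets of coordinates being zero. A $k$-form $\phi$ is viewed as the function $\frac1{k!}\phi_{i_1\dots i_k}\xi^{i_1}\cdots\xi^{i_k}$, a $k$-vector field $P$ as $\frac1{k!}P^{i_1\dots i_k}\theta_{i_1}\cdots\theta_{i_k}$, and the de Rham differential gives the function $h_d=\xi^ip_i$. A quasi-Lie bialgebroid structure on $(TM,T^*M)$ is a function $\Theta=\mu+\gamma+\varphi$ on $\mathcal E$ with $\mu,\gamma,\varphi$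 of bidegrees $(1,2),(2,1),(0,3)$ such that $$\tfrac12\{\mu,\mu\}+\{\gamma,\varphi\}=0,\quad \{\gamma,\gamma\}=0,\quad \{\mu,\gamma\}=0,\quad \{\mu,\varphi\}=0 .$$ For a bivector field $\pi$ put $F_\pi^*=\exp\{\pi,\cdot\}$, define $\tilde\pi:T^*M\to TM$ by $\beta(\tilde\pi\alpha)=\pi(\alpha,\beta)$, and for a 3-form $\phi$ define the trivector field $\wedge^3\tilde\pi\phi$ by $(\wedge^3\tilde\pi\phi)(\alpha,\beta,\gamma)=\phi(\tilde\pi\alpha,\tilde\pi\beta,\tilde\pi\gamma)$. Let $[\cdot,\cdot]$ be the Schouten bracket of multivector fields, given in coordinates by $$[P,Q]=\sum_i\Big(\frac{P\overleftarrow\partial}{\partial\theta_i}\frac{\partial Q}{\partial x^i}-\frac{\partial P}{\partial x^i}\frac{\overrightarrow\partial Q}{\partial\theta_i}\Big),$$ so that $[X,f]=Xf$ and $[X,Y]$ is the Lie bracket for vector fields $X,Y$ and functions $f$. Then: 1. For every 3-form $\phi$, the function $\Theta_\phi=h_d+\phi$ satisfies the structure equation $\{\Theta_\phi,\Theta_\phi\}=0$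 if and only if $d\phi=0$. 2. For every closed 3-form $\phi$ and every bivector field $\pi$, the twist $F_\pi^*\Theta_\phi$ is a quasi-Lie bialgebroid structure on $(TM,T^*M)$ if and only if $$\tfrac12[\pi,\pi]=\wedge^3\tilde\pi\phi .\qquad(*)$$ 3. For $f,g\in C^\infty(M)$ put $\{f,g\}=[[f,\pi],g]$ and $X_f=\{f,\cdot\}$; explicitly, $\{f,g\}=-\pi(df,dg)$ and $X_f=-\tilde\pi(df)$. For every 3-form $\phi$ and every bivector field $\pi$, equation $(*)$ holds if and only if $$\{\{f,g\},h\}+\{\{g,h\},f\}+\{\{h,f\},g\}=\phi(X_f,X_g,X_h)\qquad\text{for all } f,g,h\in C^\infty(M).$$ -/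

import Mathlib

open scoped Manifold ContDiff TensorProduct

namespace TwistedPoisson

noncomputable section

/-! ### Smooth functions on an open subset of Euclidean space -/

/-- The model space `ℝⁿ`. -/
abbrev Eucl (n : ℕ) : Type := EuclideanSpace ℝ (Fin n)

/-- The standard basis of `ℝⁿ`. -/
abbrev stdVec {n : ℕ} (i : Fin n) : Eucl n := EuclideanSpace.single i (1 : ℝ)

/-- Extension by zero of a function on an open set. It is only ever differentiated at points of
the open set. -/
def extZero {n : ℕ} {U : TopologicalSpace.Opens (Eucl n)} (f : U → ℝ) : Eucl n → ℝ :=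
  Function.extend ((↑) : U → Eucl n) f 0

theorem extZero_coe {n : ℕ} {U : TopologicalSpace.Opens (Eucl n)} (f : U → ℝ) (x : U) :
    extZero f x = f x :=
  Subtype.val_injective.extend_apply f 0 x

theorem extZero_of_mem {n : ℕ} {U : TopologicalSpace.Opens (Eucl n)} (f : U → ℝ) {x : Eucl n}
    (hx : x ∈ U) : extZero f x = f ⟨x, hx⟩ :=
  extZero_coe f ⟨x, hx⟩

/-- The algebra `C^∞(U)` of smooth real functions on an open set `U ⊆ ℝⁿ`. -/
def Smooth {n : ℕ} (U : TopologicalSpace.Opens (Eucl n)) : Subalgebra ℝ (U → ℝ) where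
  carrier := {f | ContDiffOn ℝ ∞ (extZero f) U}
  mul_mem' {f g} hf hg := by
    refine (ContDiffOn.mul hf hg).congr fun x hx => ?_
    simp [extZero_of_mem _ hx]
  add_mem' {f g} hf hg := by
    refine (ContDiffOn.add hf hg).congr fun x hx => ?_
    simp [extZero_of_mem _ hx]
  algebraMap_mem' r := by
    refine (contDiffOn_const (c := r)).congr fun x hx => ?_
    rw [extZero_of_mem _ hx]
    rfl

/-- A function that is smooth on `U`, as an element of `C^∞(U)`. -/
def Smooth.mk' {n : ℕ} (U : TopologicalSpace.Opens (Eucl n)) (f : Eucl n → ℝ)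
    (hf : ContDiffOn ℝ ∞ f U) : Smooth U :=
  ⟨fun x => f x, hf.congr fun _ hx => extZero_of_mem _ hx⟩

/-- The partial derivative `∂/∂xⁱ : C^∞(U) → C^∞(U)`. -/
def Smooth.partialDeriv {n : ℕ} {U : TopologicalSpace.Opens (Eucl n)} (i : Fin n) :
    Smooth U →ₗ[ℝ] Smooth U where
  toFun f := ⟨fun x => fderiv ℝ (extZero f.1) x (stdVec i), by
    have h : ContDiffOn ℝ ∞ (fderiv ℝ (extZero f.1)) U :=
      ContDiffOn.fderiv_of_isOpen f.2 U.isOpen (by simp)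
    exact (h.clm_apply contDiffOn_const).congr fun x hx => extZero_of_mem _ hx⟩
  map_add' f g := by
    ext x
    have hd (k : Smooth U) : DifferentiableAt ℝ (extZero k.1) x :=
      (k.2.contDiffAt (U.isOpen.mem_nhds x.2)).differentiableAt (by simp)
    have he : extZero (f + g).1 =ᶠ[nhds (x : Eucl n)] extZero f.1 + extZero g.1 := by
      filter_upwards [U.isOpen.mem_nhds x.2] with y hy
      simp [extZero_of_mem _ (show y ∈ U from hy)]
    simp only [he.fderiv_eq, fderiv_add (hd f) (hd g)]
    rfl
  map_smul' r f := by
    ext x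
    have hd : DifferentiableAt ℝ (extZero f.1) x :=
      (f.2.contDiffAt (U.isOpen.mem_nhds x.2)).differentiableAt (by simp)
    have he : extZero (r • f).1 =ᶠ[nhds (x : Eucl n)] r • extZero f.1 := by
      filter_upwards [U.isOpen.mem_nhds x.2] with y hy
      simp [extZero_of_mem _ (show y ∈ U from hy)]
    simp only [he.fderiv_eq, fderiv_const_smul hd]
    rfl

/-! ### The supermanifold `T*ΠTU` in Darboux coordinates `(xⁱ, ξⁱ, pᵢ, θᵢ)` -/

/-- The exterior algebra on the odd coordinates `ξ¹, …, ξⁿ, θ₁, …, θₙ`. -/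
abbrev OddAlg (n : ℕ) : Type := ExteriorAlgebra ℝ (Fin n ⊕ Fin n → ℝ)

/-- The algebra `C^∞(U) ⊗ ℝ[p₁, …, pₙ] ⊗ Λ[ξ¹, …, ξⁿ, θ₁, …, θₙ]` of (polynomial) functions on
`T*ΠTU`: smooth in the `xⁱ`, polynomial in the `pᵢ`, with anticommuting `ξⁱ`, `θᵢ`. -/
def SuperFun {n : ℕ} (U : TopologicalSpace.Opens (Eucl n)) : Type :=
  Smooth U ⊗[ℝ] (MvPolynomial (Fin n) ℝ ⊗[ℝ] OddAlg n)

instance {n : ℕ} (U : TopologicalSpace.Opens (Eucl n)) : Ring (SuperFun U) :=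
  inferInstanceAs (Ring (Smooth U ⊗[ℝ] (MvPolynomial (Fin n) ℝ ⊗[ℝ] OddAlg n)))

instance {n : ℕ} (U : TopologicalSpace.Opens (Eucl n)) : Algebra ℝ (SuperFun U) :=
  inferInstanceAs (Algebra ℝ (Smooth U ⊗[ℝ] (MvPolynomial (Fin n) ℝ ⊗[ℝ] OddAlg n)))

/-- The element `f ⊗ q ⊗ ω` of the algebra of functions on `T*ΠTU`. -/
def SuperFun.mk {n : ℕ} {U : TopologicalSpace.Opens (Eucl n)} (f : Smooth U)
    (q : MvPolynomial (Fin n) ℝ) (w : OddAlg n) : SuperFun U :=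
  (f ⊗ₜ[ℝ] (q ⊗ₜ[ℝ] w) : Smooth U ⊗[ℝ] (MvPolynomial (Fin n) ℝ ⊗[ℝ] OddAlg n))

section Local

variable {n : ℕ} {U : TopologicalSpace.Opens (Eucl n)}

/-- A smooth function of `x`, as a function on `T*ΠTU`. -/
def fn (f : Smooth U) : SuperFun U := .mk f 1 1

/-- The coordinate `pᵢ` (even). -/
def p (i : Fin n) : SuperFun U := .mk 1 (MvPolynomial.X i) 1

/-- The coordinate `ξⁱ` (odd). -/
def ξ (i : Fin n) : SuperFun U :=
  .mk 1 1 (ExteriorAlgebra.ι ℝ (Pi.single (Sum.inl i) 1))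

/-- The coordinate `θᵢ` (odd). -/
def θ (i : Fin n) : SuperFun U :=
  .mk 1 1 (ExteriorAlgebra.ι ℝ (Pi.single (Sum.inr i) 1))

/-- `∂/∂xⁱ`. -/
def dx (i : Fin n) : SuperFun U →ₗ[ℝ] SuperFun U :=
  LinearMap.rTensor (MvPolynomial (Fin n) ℝ ⊗[ℝ] OddAlg n) (Smooth.partialDeriv i)

/-- `∂/∂pᵢ`. -/
def dp (i : Fin n) : SuperFun U →ₗ[ℝ] SuperFun U :=
  LinearMap.lTensor (Smooth U) (LinearMap.rTensor (OddAlg n) (MvPolynomial.pderiv i).toLinearMap)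

/-- The left derivative with respect to an odd coordinate (`Sum.inl i` for `ξⁱ` and `Sum.inr i`
for `θᵢ`). -/
def oddLeft (a : Fin n ⊕ Fin n) : SuperFun U →ₗ[ℝ] SuperFun U :=
  LinearMap.lTensor (Smooth U) (LinearMap.lTensor (MvPolynomial (Fin n) ℝ)
    (CliffordAlgebra.contractLeft (Q := (0 : QuadraticForm ℝ (Fin n ⊕ Fin n → ℝ)))
      (LinearMap.proj a)))

/-- The right derivative with respect to an odd coordinate. -/
def oddRight (a : Fin n ⊕ Fin n) : SuperFun U →ₗ[ℝ] SuperFun U :=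
  LinearMap.lTensor (Smooth U) (LinearMap.lTensor (MvPolynomial (Fin n) ℝ)
    ((CliffordAlgebra.contractRight (Q := (0 : QuadraticForm ℝ (Fin n ⊕ Fin n → ℝ)))).flip
      (LinearMap.proj a)))

/-- The canonical Poisson bracket of `T*ΠTU`, with
`{pᵢ, xʲ} = δᵢʲ = -{xʲ, pᵢ}` and `{ξʲ, θᵢ} = δᵢʲ = {θᵢ, ξʲ}`. -/
def bracket (F G : SuperFun U) : SuperFun U :=
  ∑ i : Fin n, (dp i F * dx i G - dx i F * dp i G
    + oddRight (Sum.inl i) F * oddLeft (Sum.inr i) G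
    + oddRight (Sum.inr i) F * oddLeft (Sum.inl i) G)

/-- The functions of bidegree `(k, l)`, where `x`, `ξ`, `θ`, `p` have the bidegrees
`(0,0)`, `(0,1)`, `(1,0)`, `(1,1)`. -/
def bidegree (U : TopologicalSpace.Opens (Eucl n)) (k l : ℕ) : Submodule ℝ (SuperFun U) :=
  Submodule.span ℝ {F | ∃ (f : Smooth U) (P I J : List (Fin n)),
    P.length + J.length = k ∧ P.length + I.length = l ∧
    F = fn f * (P.map p).prod * (I.map ξ).prod * (J.map θ).prod}

/-- The pull-back `exp {H, ·} = 1 + {H, ·} + ½ {H, {H, ·}} + ⋯` by the time one flow of the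
Hamiltonian vector field of `H`. It is only used for bivectors `H`, for which the series applied to
any function has finitely many nonzero terms. -/
def expHam (H F : SuperFun U) : SuperFun U :=
  ∑ᶠ k : ℕ, ((k.factorial : ℝ)⁻¹) • ((bracket H)^[k] F)

/-- The de Rham vector field `ξⁱ ∂/∂xⁱ` of `ΠTU` as a fibrewise linear function `ξⁱ pᵢ`. -/
def deRhamHam (U : TopologicalSpace.Opens (Eucl n)) : SuperFun U :=
  ∑ i : Fin n, ξ i * p i

/-- The Schouten bracket of multivector fields on `U`, that is, of functions of `x` and `θ`. It
extends `[X, f] = X f` and the Lie bracket of vector fields. -/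
def schouten (P Q : SuperFun U) : SuperFun U :=
  ∑ i : Fin n, (oddRight (Sum.inr i) P * dx i Q - dx i P * oddLeft (Sum.inr i) Q)

end Local

/-! ### Tensor fields on a manifold -/

section Global

variable {n : ℕ} {M : Type*} [TopologicalSpace M] [ChartedSpace (Eucl n) M]

/-- The charts of the smooth structure of `M`. -/
abbrev Chart (n : ℕ) (M : Type*) [TopologicalSpace M] [ChartedSpace (Eucl n) M] : Type _ :=
  ↥(IsManifold.maximalAtlas (𝓡 n) ∞ M)

/-- The open subset of `ℝⁿ` which is the image of a chart. -/
def Chart.dom (c : Chart n M) : TopologicalSpace.Opens (Eucl n) :=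
  ⟨c.1.target, c.1.open_target⟩

/-- The point with coordinates `y` in the chart `c`. -/
def Chart.pt (c : Chart n M) (y : Eucl n) : M := c.1.symm y

/-- The differential at `y` of the inverse of a chart. It maps `eᵢ` to `∂/∂xⁱ`. -/
def Chart.frame (c : Chart n M) (y : Eucl n) : Eucl n →L[ℝ] TangentSpace (𝓡 n) (c.pt y) :=
  mfderiv 𝓘(ℝ, Eucl n) (𝓡 n) c.1.symm y

/-- The differential `dxⁱ` of a coordinate, at the point with coordinates `y`. -/
def Chart.coframe (c : Chart n M) (y : Eucl n) (i : Fin n) :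
    Module.Dual ℝ (TangentSpace (𝓡 n) (c.pt y)) :=
  (EuclideanSpace.proj (𝕜 := ℝ) i).toLinearMap ∘ₗ
    (mfderiv (𝓡 n) 𝓘(ℝ, Eucl n) c.1 (c.pt y) :
      TangentSpace (𝓡 n) (c.pt y) →L[ℝ] Eucl n).toLinearMap

/-- The expression of a family of alternating forms on tangent spaces in a chart. -/
def localForm {k : ℕ} (φ : ∀ x : M, TangentSpace (𝓡 n) x [⋀^Fin k]→L[ℝ] ℝ) (c : Chart n M)
    (y : Eucl n) : Eucl n [⋀^Fin k]→L[ℝ] ℝ :=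
  (φ (c.pt y)).compContinuousLinearMap (c.frame y)

variable (n M) in
/-- Smooth differential `k`-forms on `M`. -/
structure DiffForm (k : ℕ) where
  /-- The value at a point. -/
  val : ∀ x : M, TangentSpace (𝓡 n) x [⋀^Fin k]→L[ℝ] ℝ
  /-- Smoothness in charts. -/
  smooth : ∀ c : Chart n M, ContDiffOn ℝ ∞ (localForm val c) c.dom

/-- A differential form is closed if its exterior derivative vanishes. -/
def DiffForm.IsClosed {k : ℕ} (φ : DiffForm n M k) : Prop :=
  ∀ c : Chart n M, ∀ y ∈ c.dom, extDeriv (localForm φ.val c) y = 0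

/-- The components `P(dx^{i₁}, …, dx^{iₖ})` of a family of multivectors in a chart. -/
def localComp {k : ℕ} (P : ∀ x : M, Module.Dual ℝ (TangentSpace (𝓡 n) x) [⋀^Fin k]→ₗ[ℝ] ℝ)
    (c : Chart n M) (i : Fin k → Fin n) (y : Eucl n) : ℝ :=
  P (c.pt y) fun a => c.coframe y (i a)

variable (n M) in
/-- Smooth `k`-vector fields on `M`. A `k`-vector is an alternating form on covectors. -/
structure MultiVec (k : ℕ) where
  /-- The value at a point. -/
  val : ∀ x : M, Module.Dual ℝ (TangentSpace (𝓡 n) x) [⋀^Fin k]→ₗ[ℝ] ℝ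
  /-- Smoothness of the components in charts. -/
  smooth : ∀ (c : Chart n M) (i : Fin k → Fin n), ContDiffOn ℝ ∞ (localComp val c i) c.dom

instance (x : M) : Module.Finite ℝ (TangentSpace (𝓡 n) x) :=
  inferInstanceAs (Module.Finite ℝ (Eucl n))

theorem update_pair {V : Type*} (a b c : V) : Function.update ![a, b] 1 c = ![a, c] := by
  ext i
  fin_cases i <;> simp

/-- The map `π̃ : T*M → TM` of a bivector field, `β(π̃ α) = π(α, β)`. -/
def sharp (π : MultiVec n M 2) (x : M) :
    Module.Dual ℝ (TangentSpace (𝓡 n) x) →ₗ[ℝ] TangentSpace (𝓡 n) x :=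
  (Module.evalEquiv ℝ (TangentSpace (𝓡 n) x)).symm.toLinearMap ∘ₗ
    LinearMap.mk₂ ℝ (fun α β => π.val x ![α, β])
      (fun α α' β => by simpa using (π.val x).map_vecCons_add ![β] α α')
      (fun r α β => by simpa using (π.val x).map_vecCons_smul ![β] r α)
      (fun α β β' => by
        have h := (π.val x).map_update_add ![α, β] 1 β β'
        rwa [update_pair, update_pair, update_pair] at h)
      (fun r α β => by
        have h := (π.val x).map_update_smul ![α, β] 1 r β
        rwa [update_pair, update_pair] at h)

theorem sharp_apply (π : MultiVec n M 2) (x : M)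
    (α β : Module.Dual ℝ (TangentSpace (𝓡 n) x)) : β (sharp π x α) = π.val x ![α, β] := by
  simp [sharp]

theorem Chart.mdifferentiable [IsManifold (𝓡 n) ∞ M] (c : Chart n M) :
    c.1.MDifferentiable (𝓡 n) (𝓡 n) :=
  ⟨(contMDiffOn_of_mem_maximalAtlas c.2).mdifferentiableOn (by simp),
    (contMDiffOn_symm_of_mem_maximalAtlas c.2).mdifferentiableOn (by simp)⟩

theorem Chart.frame_coframe [IsManifold (𝓡 n) ∞ M] (c : Chart n M) {y : Eucl n} (hy : y ∈ c.dom)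
    (v : TangentSpace (𝓡 n) (c.pt y)) :
    ∑ l, c.coframe y l v • c.frame y (stdVec l) = v := by
  have hs : c.pt y ∈ c.1.source := c.1.map_target hy
  have h := DFunLike.congr_fun (c.mdifferentiable.symm_comp_deriv hs) v
  have hc : c.1 (c.pt y) = y := c.1.right_inv hy
  have key : c.frame y (mfderiv (𝓡 n) 𝓘(ℝ, Eucl n) c.1 (c.pt y) v) = v := by
    rw [hc] at h
    exact h
  conv_rhs => rw [← key]
  set w : Eucl n := mfderiv (𝓡 n) 𝓘(ℝ, Eucl n) c.1 (c.pt y) v with hw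
  have hsum : w = ∑ l, w l • stdVec l := by
    ext k
    simp [Finset.sum_apply, Pi.single_apply]
  conv_rhs => rw [hsum, map_sum]
  refine Finset.sum_congr rfl fun l _ => ?_
  rw [map_smul]
  rfl

theorem sharp_coframe [IsManifold (𝓡 n) ∞ M] (π : MultiVec n M 2) (c : Chart n M) {y : Eucl n}
    (hy : y ∈ c.dom) (j : Fin n) :
    sharp π (c.pt y) (c.coframe y j) =
      c.frame y (∑ l, localComp π.val c ![j, l] y • stdVec l) := by
  rw [← c.frame_coframe hy (sharp π (c.pt y) (c.coframe y j)), map_sum]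
  refine Finset.sum_congr rfl fun l _ => ?_
  rw [map_smul, sharp_apply]
  congr 2
  ext i
  fin_cases i <;> rfl

theorem DiffForm.smooth_apply {k : ℕ} (φ : DiffForm n M k) (c : Chart n M) (v : Fin k → Eucl n) :
    ContDiffOn ℝ ∞ (fun y => localForm φ.val c y v) c.dom :=
  (ContinuousAlternatingMap.apply ℝ (Eucl n) ℝ v).contDiff.comp_contDiffOn (φ.smooth c)

/-- The `k`-vector field `∧ᵏπ̃ φ` obtained by raising all indices of a `k`-form `φ` with a bivector
field `π`, that is, `(∧ᵏπ̃ φ)(α₁, …, αₖ) = φ(π̃ α₁, …, π̃ αₖ)`. -/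
def raise [IsManifold (𝓡 n) ∞ M] {k : ℕ} (π : MultiVec n M 2) (φ : DiffForm n M k) :
    MultiVec n M k where
  val x := (φ.val x).toAlternatingMap.compLinearMap (sharp π x)
  smooth c i := by
    have h : ∀ y ∈ c.dom, localComp
        (fun x => (φ.val x).toAlternatingMap.compLinearMap (sharp π x)) c i y =
        ∑ r : Fin k → Fin n, (∏ a, localComp π.val c ![i a, r a] y) *
          localForm φ.val c y (fun a => stdVec (r a)) := by
      intro y hy
      have h1 : localComp (fun x => (φ.val x).toAlternatingMap.compLinearMap (sharp π x)) c i y =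
          localForm φ.val c y
            (fun a => ∑ l, localComp π.val c ![i a, l] y • stdVec l) := by
        change φ.val (c.pt y) (fun a => sharp π (c.pt y) (c.coframe y (i a))) =
          φ.val (c.pt y) (fun a => c.frame y (∑ l, localComp π.val c ![i a, l] y • stdVec l))
        congr 1
        ext1 a
        exact sharp_coframe π c hy (i a)
      rw [h1, ContinuousAlternatingMap.map_sum]
      refine Finset.sum_congr rfl fun r _ => ?_
      rw [ContinuousAlternatingMap.map_smul_univ, smul_eq_mul]
    refine ContDiffOn.congr ?_ h
    refine ContDiffOn.sum fun r _ => ContDiffOn.mul ?_ (φ.smooth_apply c _)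
    exact contDiffOn_prod fun a _ => π.smooth c _

/-! ### Functions on `ℰ = T*ΠTM` -/

variable (n M) in
/-- Functions on `ℰ = T*ΠTM` are described by their expressions in the Darboux coordinates
`(xⁱ, ξⁱ, pᵢ, θᵢ)` induced by the charts of `M`: two functions on `ℰ` are equal if and only if they
have the same expression in every chart, and the bracket is computed in charts. (A family of
expressions comes from a function on `ℰ` if it is compatible with coordinate changes; this holds
for `h_d`, for the functions given by tensor fields, and for everything obtained from these by
brackets, since a change of coordinates of `M` induces a canonical transformation.) -/
abbrev DoubleFun : Type _ := ∀ c : Chart n M, SuperFun c.dom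

/-- The canonical Poisson bracket of `ℰ`. -/
def poisson (F G : DoubleFun n M) : DoubleFun n M := fun c => bracket (F c) (G c)

variable (n M) in
/-- The function `h_d` on `ℰ` given by the de Rham vector field on `ΠTM`. -/
def hd : DoubleFun n M := fun c => deRhamHam c.dom

/-- A smooth function `f` on `M`, as a function on `ℰ`. -/
def ofFun (f : C^∞⟮𝓡 n, M; 𝓘(ℝ, ℝ), ℝ⟯) : DoubleFun n M := fun c =>
  fn (Smooth.mk' c.dom (fun y => f (c.pt y)) (by
    have h : ContMDiffOn (𝓡 n) 𝓘(ℝ, ℝ) ∞ (f ∘ c.1.symm) c.1.target :=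
      f.contMDiff.comp_contMDiffOn (contMDiffOn_symm_of_mem_maximalAtlas c.2)
    exact contMDiffOn_iff_contDiffOn.mp h))

/-- The function `(1/k!) φ_{i₁…iₖ}(x) ξ^{i₁} ⋯ ξ^{iₖ}` on `ℰ` given by a differential form. -/
def ofForm {k : ℕ} (φ : DiffForm n M k) : DoubleFun n M := fun c =>
  ((k.factorial : ℝ)⁻¹) • ∑ i : Fin k → Fin n,
    fn (Smooth.mk' c.dom (fun y => localForm φ.val c y fun a => stdVec (i a))
      (φ.smooth_apply c _)) * (List.ofFn fun a => ξ (i a)).prod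

/-- The function `(1/k!) P^{i₁…iₖ}(x) θ_{i₁} ⋯ θ_{iₖ}` on `ℰ` given by a multivector field. -/
def ofMultiVec {k : ℕ} (P : MultiVec n M k) : DoubleFun n M := fun c =>
  ((k.factorial : ℝ)⁻¹) • ∑ i : Fin k → Fin n,
    fn (Smooth.mk' c.dom (localComp P.val c i) (P.smooth c i)) *
      (List.ofFn fun a => θ (i a)).prod

/-- The twist `F_π^* Θ = exp {π, ·} Θ` of a function on `ℰ` by a bivector field. -/
def twist (π : MultiVec n M 2) (Θ : DoubleFun n M) : DoubleFun n M :=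
  fun c => expHam (ofMultiVec π c) (Θ c)

/-- The Schouten bracket of multivector fields, viewed as functions on `ℰ`. -/
def schoutenBracket (P Q : DoubleFun n M) : DoubleFun n M := fun c => schouten (P c) (Q c)

/-- The structure equation `{Θ, Θ} = 0`. -/
def StructureEq (Θ : DoubleFun n M) : Prop := poisson Θ Θ = 0

/-- A function on `ℰ` is of bidegree `(k, l)`. -/
def HasBidegree (F : DoubleFun n M) (k l : ℕ) : Prop := ∀ c, F c ∈ bidegree c.dom k l

/-- `Θ` is a quasi-Lie bialgebroid structure on `(TM, T*M)`: it is the sum of functions `μ`, `γ`,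
`φ` on `ℰ` of bidegrees `(1, 2)`, `(2, 1)`, `(0, 3)` which satisfy the four defining equations. -/
def IsQuasiLieBialgebroid (Θ : DoubleFun n M) : Prop :=
  ∃ μ γ φ : DoubleFun n M,
    HasBidegree μ 1 2 ∧ HasBidegree γ 2 1 ∧ HasBidegree φ 0 3 ∧ Θ = μ + γ + φ ∧
    (1 / 2 : ℝ) • poisson μ μ + poisson γ φ = 0 ∧ poisson γ γ = 0 ∧
    poisson μ γ = 0 ∧ poisson μ φ = 0

/-! ### The bracket of functions on `M` -/

/-- The differential `df` at a point. -/
def diff (f : M → ℝ) (x : M) : Module.Dual ℝ (TangentSpace (𝓡 n) x) :=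
  (mfderiv (𝓡 n) 𝓘(ℝ, ℝ) f x : TangentSpace (𝓡 n) x →L[ℝ] ℝ).toLinearMap

/-- The bracket of functions `{f, g} = [[f, π], g]` defined by a bivector field, which in terms of
the pairing of bivectors and covectors is `-π(df, dg)`. -/
def funBracket (π : MultiVec n M 2) (f g : M → ℝ) (x : M) : ℝ :=
  -π.val x ![diff f x, diff g x]

/-- The vector field `X_f = {f, ·}`. -/
def hamVec (π : MultiVec n M 2) (f : M → ℝ) (x : M) : TangentSpace (𝓡 n) x :=
  -sharp π x (diff f x)

theorem hamVec_apply (π : MultiVec n M 2) (f g : M → ℝ) (x : M) :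
    diff g x (hamVec π f x) = funBracket π f g x := by
  simp [hamVec, funBracket, sharp_apply]

end Global

end

end TwistedPoisson

/-! All equations between functions on `T*ΠTM` are tested chart by chart, so the first two claims
are identities in the algebra `SuperFun U`. Write `D = {π, ·}`. Since `π` is even and depends on `x`
and `θ` only, `D` is a derivation of the product and of the bracket
(`IsEvenMultivector.bracket_mul`, `IsEvenMultivector.bracket_bracket`), and it shifts bidegree by
`(1, -1)`.

Claim 1: `{h_d, h_d}` and `{φ, φ}` vanish, and odd functions have a symmetric bracket, so the
structure equation reduces to `2 {h_d, φ} = 0`. But `{h_d, φ} = ξⁱ ∂φ/∂xⁱ` is `dφ` written as a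
function (`contracted_extDerivComp`).

Claim 2: `D` sends `ξʲ` to a combination `bʲ` of the `θ` and kills `bʲ`. Hence `D⁴φ = 0`, and
`D³φ/6` is `φ` with every `ξʲ` replaced by `bʲ`, which is `∧³π̃φ` (`contracted_raised`). Also `D²
h_d = -[π, π]` and `D³ h_d = 0`. The twist therefore has components `φ`, `h_d + Dφ`, `D h_d + ½ D²φ`
of the three admissible bidegrees, plus the obstruction `∧³π̃φ - ½ [π, π]` of bidegree `(3, 0)`.
Setting `p = ξ = 0` isolates the obstruction, so it must vanish (`twist_isQuasi_iff`). Conversely,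
once it vanishes, the four defining equations are the bihomogeneous components of the twisted
structure equation, obtained by applying powers of `D` to `{h_d, h_d} = {h_d, φ} = {φ, φ} = 0`
(`IsEvenMultivector.twist_equations`); closedness of `φ` supplies the middle identity.

Claim 3: in coordinates the Jacobiator of `-π(df, dg)` loses all its second derivatives of functions
and becomes `-½ [π, π](df, dg, dh)` (`derivation_jacobi`, `schouten_self`). The three signs in `X_f
= -π̃(df)` give `φ(X_f, X_g, X_h) = -(∧³π̃φ)(df, dg, dh)`. The two trivectors agree once they agree
on differentials of global functions, because bump functions realize every coordinate differential
at a point (`exists_partialDeriv_eq`). -/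

namespace TwistedPoisson

noncomputable section

/-! ### The graded commutative algebra of functions and its derivations -/

section SuperAlgebra

variable {n : ℕ} {U : TopologicalSpace.Opens (Eucl n)}

/-- Linear and bilinear identities need only be checked on pure tensors. The zero tensor is itself
of the form `.mk f 0 0`, so no separate case for it is required. -/
theorem SuperFun.induction {P : SuperFun U → Prop}
    (hmk : ∀ f q w, P (.mk f q w)) (hadd : ∀ F G, P F → P G → P (F + G))
    (F : SuperFun U) : P F := by
  have h0 : ∀ f : Smooth U, (0 : SuperFun U) = .mk f 0 0 := fun f => by
    change (0 : Smooth U ⊗[ℝ] (MvPolynomial (Fin n) ℝ ⊗[ℝ] OddAlg n)) = f ⊗ₜ[ℝ] (0 ⊗ₜ[ℝ] 0)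
    simp
  refine TensorProduct.induction_on (motive := P) F ?_ (fun f t => ?_) hadd
  · change P (0 : SuperFun U)
    rw [h0 0]
    exact hmk _ _ _
  · induction t using TensorProduct.induction_on with
    | zero =>
      rw [TensorProduct.tmul_zero]
      change P (0 : SuperFun U)
      rw [h0 f]
      exact hmk _ _ _
    | tmul q w => exact hmk _ _ _
    | add s t hs ht =>
      rw [TensorProduct.tmul_add]
      exact hadd _ _ hs ht

theorem SuperFun.mk_mul_mk (f g : Smooth U) (q r : MvPolynomial (Fin n) ℝ) (v w : OddAlg n) :
    SuperFun.mk f q v * SuperFun.mk g r w = SuperFun.mk (f * g) (q * r) (v * w) :=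
  (Algebra.TensorProduct.tmul_mul_tmul f g (q ⊗ₜ[ℝ] v) (r ⊗ₜ[ℝ] w)).trans
    (congrArg (fun t => (f * g) ⊗ₜ[ℝ] t) (Algebra.TensorProduct.tmul_mul_tmul q r v w))

theorem SuperFun.mk_add_left (f g : Smooth U) (q : MvPolynomial (Fin n) ℝ) (w : OddAlg n) :
    SuperFun.mk (f + g) q w = SuperFun.mk f q w + SuperFun.mk g q w :=
  TensorProduct.add_tmul _ _ _

theorem SuperFun.mk_add_mid (f : Smooth U) (q r : MvPolynomial (Fin n) ℝ) (w : OddAlg n) :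
    SuperFun.mk f (q + r) w = SuperFun.mk f q w + SuperFun.mk f r w := by
  unfold SuperFun.mk
  rw [TensorProduct.add_tmul, TensorProduct.tmul_add]
  rfl

theorem SuperFun.mk_add_right (f : Smooth U) (q : MvPolynomial (Fin n) ℝ) (v w : OddAlg n) :
    SuperFun.mk f q (v + w) = SuperFun.mk f q v + SuperFun.mk f q w := by
  unfold SuperFun.mk
  rw [TensorProduct.tmul_add, TensorProduct.tmul_add]
  rfl

theorem SuperFun.mk_neg_right (f : Smooth U) (q : MvPolynomial (Fin n) ℝ) (w : OddAlg n) :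
    SuperFun.mk f q (-w) = -SuperFun.mk f q w := by
  rw [eq_neg_iff_add_eq_zero, ← SuperFun.mk_add_right, neg_add_cancel]
  unfold SuperFun.mk
  rw [TensorProduct.tmul_zero, TensorProduct.tmul_zero]
  rfl

theorem SuperFun.mk_zero_right (f : Smooth U) (q : MvPolynomial (Fin n) ℝ) :
    SuperFun.mk f q 0 = 0 := by
  unfold SuperFun.mk
  rw [TensorProduct.tmul_zero, TensorProduct.tmul_zero]
  rfl

theorem SuperFun.mk_zero_mid (f : Smooth U) (w : OddAlg n) :
    SuperFun.mk f 0 w = 0 := by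
  unfold SuperFun.mk
  rw [TensorProduct.zero_tmul, TensorProduct.tmul_zero]
  rfl

theorem SuperFun.mk_zero_left (q : MvPolynomial (Fin n) ℝ) (w : OddAlg n) :
    (SuperFun.mk 0 q w : SuperFun U) = 0 :=
  TensorProduct.zero_tmul _ _

/-! ### Parity -/

/-- The parity involution of the algebra of functions, `F ↦ (-1)^{|F|} F`. -/
def parity : SuperFun U →ₐ[ℝ] SuperFun U :=
  (Algebra.TensorProduct.map (AlgHom.id ℝ (Smooth U))
    (Algebra.TensorProduct.map (AlgHom.id ℝ (MvPolynomial (Fin n) ℝ))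
      (CliffordAlgebra.involute (Q := (0 : QuadraticForm ℝ (Fin n ⊕ Fin n → ℝ))))) :
    Smooth U ⊗[ℝ] (MvPolynomial (Fin n) ℝ ⊗[ℝ] OddAlg n) →ₐ[ℝ]
      Smooth U ⊗[ℝ] (MvPolynomial (Fin n) ℝ ⊗[ℝ] OddAlg n))

theorem parity_mk (f : Smooth U) (q : MvPolynomial (Fin n) ℝ) (w : OddAlg n) :
    parity (.mk f q w) = .mk f q (CliffordAlgebra.involute w) := rfl

theorem dx_mk (i : Fin n) (f : Smooth U) (q : MvPolynomial (Fin n) ℝ) (w : OddAlg n) :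
    dx i (.mk f q w) = .mk (Smooth.partialDeriv i f) q w := rfl

theorem dp_mk (i : Fin n) (f : Smooth U) (q : MvPolynomial (Fin n) ℝ) (w : OddAlg n) :
    dp i (.mk f q w) = .mk f (MvPolynomial.pderiv i q) w := rfl

theorem oddLeft_mk (a : Fin n ⊕ Fin n) (f : Smooth U) (q : MvPolynomial (Fin n) ℝ)
    (w : OddAlg n) : oddLeft a (.mk f q w) = .mk f q
      (CliffordAlgebra.contractLeft (Q := (0 : QuadraticForm ℝ (Fin n ⊕ Fin n → ℝ)))
        (LinearMap.proj a) w) := rfl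

theorem oddRight_mk (a : Fin n ⊕ Fin n) (f : Smooth U) (q : MvPolynomial (Fin n) ℝ)
    (w : OddAlg n) : oddRight a (.mk f q w) = .mk f q
      (CliffordAlgebra.contractRight (Q := (0 : QuadraticForm ℝ (Fin n ⊕ Fin n → ℝ)))
        w (LinearMap.proj a)) := rfl

section Clifford

open CliffordAlgebra

variable {V : Type*} [AddCommGroup V] [Module ℝ V]

theorem contractLeft_mul (d : Module.Dual ℝ V) (v w : ExteriorAlgebra ℝ V) :
    contractLeft (Q := (0 : QuadraticForm ℝ V)) d (v * w) =
      contractLeft (Q := (0 : QuadraticForm ℝ V)) d v * w +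
        involute v * contractLeft (Q := (0 : QuadraticForm ℝ V)) d w := by
  induction v using CliffordAlgebra.left_induction with
  | algebraMap r =>
    rw [contractLeft_algebraMap_mul, contractLeft_algebraMap, AlgHom.commutes]
    simp
  | add x y hx hy => simp only [add_mul, map_add, hx, hy]; abel
  | ι_mul x m hx =>
    rw [mul_assoc, contractLeft_ι_mul, hx, contractLeft_ι_mul, map_mul, involute_ι]
    simp only [mul_add, sub_mul, smul_mul_assoc, neg_mul, mul_assoc]
    abel

theorem involute_contractLeft (d : Module.Dual ℝ V) (v : ExteriorAlgebra ℝ V) :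
    involute (contractLeft (Q := (0 : QuadraticForm ℝ V)) d v) =
      -contractLeft (Q := (0 : QuadraticForm ℝ V)) d (involute v) := by
  induction v using CliffordAlgebra.left_induction with
  | algebraMap r => simp
  | add x y hx hy => simp only [map_add, hx, hy]; abel
  | ι_mul x m hx =>
    simp only [contractLeft_ι_mul, map_mul, map_sub, map_smul, involute_ι, hx, neg_mul, map_neg]
    simp

/-- A right derivative differs from the left one by the sign `(-1)^{|v|+1}`, which is the parity of
the differentiated element. This lets every right derivative in the brackets be traded for a left
derivative followed by the parity involution. -/
theorem contractRight_eq_involute (d : Module.Dual ℝ V) (v : ExteriorAlgebra ℝ V) :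
    contractRight (Q := (0 : QuadraticForm ℝ V)) v d =
      involute (contractLeft (Q := (0 : QuadraticForm ℝ V)) d v) := by
  induction v using CliffordAlgebra.right_induction with
  | algebraMap r => simp
  | add x y hx hy => simp only [map_add, LinearMap.add_apply, hx, hy]
  | mul_ι m x hx =>
    have h := contractLeft_mul d x (ι (0 : QuadraticForm ℝ V) m)
    rw [contractRight_mul_ι, hx]
    erw [h]
    rw [map_add, map_mul, map_mul, involute_involute, contractLeft_ι, involute_ι,
      AlgHom.commutes, ← Algebra.commutes, ← Algebra.smul_def]
    rw [mul_neg]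
    abel

theorem ι_mul_eq_involute_mul (m : V) (v : ExteriorAlgebra ℝ V) :
    ι (0 : QuadraticForm ℝ V) m * v = involute v * ι (0 : QuadraticForm ℝ V) m := by
  induction v using CliffordAlgebra.left_induction with
  | algebraMap r => rw [AlgHom.commutes, Algebra.commutes]
  | add x y hx hy => rw [mul_add, hx, hy, map_add, add_mul]
  | ι_mul x k hx =>
    rw [map_mul, involute_ι, mul_assoc, ← hx, ← mul_assoc, ← mul_assoc]
    congr 1
    have := ExteriorAlgebra.ι_add_mul_swap (R := ℝ) m k
    rw [neg_mul]
    exact eq_neg_of_add_eq_zero_left this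

/-- `v - involute v` is twice the odd part of `v`, so this is the sign rule for commuting an odd
element past an arbitrary one, with no homogeneous decomposition. The companion with a plus sign
treats the even part. -/
theorem mul_sub_involute (w v : ExteriorAlgebra ℝ V) :
    w * (v - involute v) = (v - involute v) * involute w := by
  induction w using CliffordAlgebra.left_induction with
  | algebraMap r => rw [AlgHom.commutes, Algebra.commutes]
  | add x y hx hy => rw [add_mul, hx, hy, map_add, mul_add]
  | ι_mul x m hx =>
    rw [mul_assoc, hx, ← mul_assoc, ι_mul_eq_involute_mul, map_mul, involute_ι, map_sub,
      involute_involute]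
    noncomm_ring

theorem mul_add_involute (w v : ExteriorAlgebra ℝ V) :
    w * (v + involute v) = (v + involute v) * w := by
  induction w using CliffordAlgebra.left_induction with
  | algebraMap r => rw [Algebra.commutes]
  | add x y hx hy => rw [add_mul, hx, hy, mul_add]
  | ι_mul x m hx =>
    rw [mul_assoc, hx, ← mul_assoc, ι_mul_eq_involute_mul, map_add,
      involute_involute, add_comm (involute v), mul_assoc]

end Clifford

theorem parity_parity (F : SuperFun U) : parity (parity F) = F := by
  induction F using SuperFun.induction with
  | hmk f q w => simp [parity_mk]
  | hadd F G hF hG => simp [hF, hG]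

theorem oddRight_eq (a : Fin n ⊕ Fin n) (F : SuperFun U) :
    oddRight a F = parity (oddLeft a F) := by
  induction F using SuperFun.induction with
  | hmk f q w => rw [oddRight_mk, oddLeft_mk, parity_mk, contractRight_eq_involute]
  | hadd F G hF hG => simp [hF, hG]

theorem parity_oddLeft (a : Fin n ⊕ Fin n) (F : SuperFun U) :
    parity (oddLeft a F) = -oddLeft a (parity F) := by
  induction F using SuperFun.induction with
  | hmk f q w =>
    rw [oddLeft_mk, parity_mk, parity_mk, oddLeft_mk, involute_contractLeft,
      SuperFun.mk_neg_right]
  | hadd F G hF hG => simp only [map_add, hF, hG]; abel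

theorem parity_dx (i : Fin n) (F : SuperFun U) : parity (dx i F) = dx i (parity F) := by
  induction F using SuperFun.induction with
  | hmk f q w => rfl
  | hadd F G hF hG => simp [hF, hG]

theorem parity_dp (i : Fin n) (F : SuperFun U) : parity (dp i F) = dp i (parity F) := by
  induction F using SuperFun.induction with
  | hmk f q w => rfl
  | hadd F G hF hG => simp [hF, hG]

theorem mul_sub_parity (F G : SuperFun U) :
    F * (G - parity G) = (G - parity G) * parity F := by
  induction G using SuperFun.induction with
  | hmk f q w =>
    induction F using SuperFun.induction with
    | hmk g r v =>
      rw [parity_mk, parity_mk, sub_eq_add_neg, ← SuperFun.mk_neg_right, ← SuperFun.mk_add_right,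
        SuperFun.mk_mul_mk, SuperFun.mk_mul_mk, ← sub_eq_add_neg, mul_sub_involute, mul_comm g,
        mul_comm r]
    | hadd F G hF hG => simp only [map_add, hF, hG, add_mul, mul_add]
  | hadd G H hG hH =>
    have : G + H - parity (G + H) = (G - parity G) + (H - parity H) := by rw [map_add]; abel
    rw [this, mul_add, hG, hH, add_mul]

theorem mul_add_parity (F G : SuperFun U) :
    F * (G + parity G) = (G + parity G) * F := by
  induction G using SuperFun.induction with
  | hmk f q w =>
    induction F using SuperFun.induction with
    | hmk g r v =>
      rw [parity_mk, ← SuperFun.mk_add_right,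
        SuperFun.mk_mul_mk, SuperFun.mk_mul_mk, mul_add_involute, mul_comm g,
        mul_comm r]
    | hadd F G hF hG => rw [add_mul, hF, hG, mul_add]
  | hadd G H hG hH =>
    have : G + H + parity (G + H) = (G + parity G) + (H + parity H) := by rw [map_add]; abel
    rw [this, mul_add, hG, hH, ← add_mul]

theorem mul_odd (F : SuperFun U) {b : SuperFun U} (hb : parity b = -b) :
    F * b = b * parity F := by
  have h := mul_sub_parity F b
  -- For odd `b` the difference `b - parity b` is `2b`; the factor 2 is then cancelled.
  rw [hb, sub_neg_eq_add, mul_add, add_mul, ← two_smul ℝ, ← two_smul ℝ (b * _)] at h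
  exact smul_right_injective _ (two_ne_zero (α := ℝ)) h

theorem mul_even (F : SuperFun U) {a : SuperFun U} (ha : parity a = a) :
    F * a = a * F := by
  have h := mul_add_parity F a
  rw [ha, mul_add, add_mul, ← two_smul ℝ, ← two_smul ℝ (a * _)] at h
  exact smul_right_injective _ (two_ne_zero (α := ℝ)) h

/-! ### Derivations -/

theorem partialDeriv_mul (i : Fin n) (f g : Smooth U) :
    Smooth.partialDeriv i (f * g) =
      Smooth.partialDeriv i f * g + f * Smooth.partialDeriv i g := by
  ext x
  have hd (k : Smooth U) : DifferentiableAt ℝ (extZero k.1) x :=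
    (k.2.contDiffAt (U.isOpen.mem_nhds x.2)).differentiableAt (by simp)
  have he : extZero (f * g).1 =ᶠ[nhds (x : Eucl n)] extZero f.1 * extZero g.1 := by
    filter_upwards [U.isOpen.mem_nhds x.2] with y hy
    simp [extZero_of_mem _ (show y ∈ U from hy)]
  change fderiv ℝ (extZero (f * g).1) x (stdVec i) =
    fderiv ℝ (extZero f.1) x (stdVec i) * g.1 x + f.1 x * fderiv ℝ (extZero g.1) x (stdVec i)
  rw [he.fderiv_eq, fderiv_mul (hd f) (hd g)]
  simp only [extZero_coe, add_apply, smul_apply,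
    smul_eq_mul]
  ring

theorem partialDeriv_comm (i j : Fin n) (f : Smooth U) :
    Smooth.partialDeriv i (Smooth.partialDeriv j f) =
      Smooth.partialDeriv j (Smooth.partialDeriv i f) := by
  ext x
  have hf : ContDiffAt ℝ ∞ (extZero f.1) x := f.2.contDiffAt (U.isOpen.mem_nhds x.2)
  have key (k l : Fin n) : (Smooth.partialDeriv k (Smooth.partialDeriv l f)).1 x =
      -- Both iterated partial derivatives are values of the second Fréchet derivative, whose
      -- symmetry gives the claim.
      fderiv ℝ (fderiv ℝ (extZero f.1)) x (stdVec k) (stdVec l) := by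
    have he : extZero (Smooth.partialDeriv l f).1 =ᶠ[nhds (x : Eucl n)]
        fun y => fderiv ℝ (extZero f.1) y (stdVec l) := by
      filter_upwards [U.isOpen.mem_nhds x.2] with y hy
      rw [extZero_of_mem _ (show y ∈ U from hy)]
      rfl
    have hd : DifferentiableAt ℝ (fderiv ℝ (extZero f.1)) x :=
      (hf.fderiv_right (m := 1) (by norm_cast)).differentiableAt (by simp)
    change fderiv ℝ (extZero (Smooth.partialDeriv l f).1) x (stdVec k) = _
    rw [he.fderiv_eq, fderiv_clm_apply hd (by fun_prop)]
    simp
  have hs : IsSymmSndFDerivAt ℝ (extZero f.1) x :=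
    hf.isSymmSndFDerivAt (by
      simp only [minSmoothness_of_isRCLikeNormedField]
      exact WithTop.coe_le_coe.mpr (le_top : (2 : ℕ∞) ≤ ⊤))
  rw [key, key]
  exact hs (stdVec i) (stdVec j)

theorem dx_mul (i : Fin n) (F G : SuperFun U) : dx i (F * G) = dx i F * G + F * dx i G := by
  induction F using SuperFun.induction with
  | hmk f q w =>
    induction G using SuperFun.induction with
    | hmk g r v =>
      simp only [SuperFun.mk_mul_mk, dx_mk, partialDeriv_mul, SuperFun.mk_add_left]
    | hadd F G hF hG => simp only [mul_add, map_add, hF, hG]; abel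
  | hadd F G hF hG => simp only [add_mul, map_add, hF, hG]; abel

theorem dp_mul (i : Fin n) (F G : SuperFun U) : dp i (F * G) = dp i F * G + F * dp i G := by
  induction F using SuperFun.induction with
  | hmk f q w =>
    induction G using SuperFun.induction with
    | hmk g r v =>
      simp only [SuperFun.mk_mul_mk, dp_mk, Derivation.leibniz, SuperFun.mk_add_mid, smul_eq_mul]
      rw [mul_comm r, add_comm]
    | hadd F G hF hG => simp only [mul_add, map_add, hF, hG]; abel
  | hadd F G hF hG => simp only [add_mul, map_add, hF, hG]; abel

theorem oddLeft_mul (a : Fin n ⊕ Fin n) (F G : SuperFun U) :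
    oddLeft a (F * G) = oddLeft a F * G + parity F * oddLeft a G := by
  induction F using SuperFun.induction with
  | hmk f q w =>
    induction G using SuperFun.induction with
    | hmk g r v =>
      simp only [SuperFun.mk_mul_mk, oddLeft_mk, parity_mk]
      rw [contractLeft_mul, SuperFun.mk_add_right]
    | hadd F G hF hG => simp only [mul_add, map_add, hF, hG]; abel
  | hadd F G hF hG => simp only [add_mul, map_add, hF, hG]; abel

theorem dx_comm (i j : Fin n) (F : SuperFun U) : dx i (dx j F) = dx j (dx i F) := by
  induction F using SuperFun.induction with
  | hmk f q w => simp only [dx_mk, partialDeriv_comm i j]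
  | hadd F G hF hG => simp [hF, hG]

theorem pderiv_comm (i j : Fin n) (q : MvPolynomial (Fin n) ℝ) :
    MvPolynomial.pderiv i (MvPolynomial.pderiv j q) =
      MvPolynomial.pderiv j (MvPolynomial.pderiv i q) := by
  induction q using MvPolynomial.induction_on with
  | C a => simp
  | add p q hp hq => simp [hp, hq]
  | mul_X p k hp =>
    simp only [Derivation.leibniz, smul_eq_mul, map_add, MvPolynomial.pderiv_X, hp,
      Pi.single_apply]
    split_ifs <;> simp <;> ring

theorem dp_comm (i j : Fin n) (F : SuperFun U) : dp i (dp j F) = dp j (dp i F) := by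
  induction F using SuperFun.induction with
  | hmk f q w => simp only [dp_mk, pderiv_comm i j]
  | hadd F G hF hG => simp [hF, hG]

theorem dx_dp (i j : Fin n) (F : SuperFun U) : dx i (dp j F) = dp j (dx i F) := by
  induction F using SuperFun.induction with
  | hmk f q w => rfl
  | hadd F G hF hG => simp [hF, hG]

theorem dx_oddLeft (i : Fin n) (a : Fin n ⊕ Fin n) (F : SuperFun U) :
    dx i (oddLeft a F) = oddLeft a (dx i F) := by
  induction F using SuperFun.induction with
  | hmk f q w => rfl
  | hadd F G hF hG => simp [hF, hG]

theorem dp_oddLeft (i : Fin n) (a : Fin n ⊕ Fin n) (F : SuperFun U) :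
    dp i (oddLeft a F) = oddLeft a (dp i F) := by
  induction F using SuperFun.induction with
  | hmk f q w => rfl
  | hadd F G hF hG => simp [hF, hG]

theorem oddLeft_comm (a b : Fin n ⊕ Fin n) (F : SuperFun U) :
    oddLeft a (oddLeft b F) = -oddLeft b (oddLeft a F) := by
  induction F using SuperFun.induction with
  | hmk f q w =>
    rw [oddLeft_mk, oddLeft_mk, oddLeft_mk, oddLeft_mk, ← SuperFun.mk_neg_right]
    congr 1
    exact CliffordAlgebra.contractLeft_comm _ _ _
  | hadd F G hF hG => simp only [map_add, hF, hG]; abel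

/-! ### Values on coordinates -/

theorem parity_fn (f : Smooth U) : parity (fn f) = fn f := by
  simp [fn, parity_mk]

theorem parity_p (i : Fin n) : parity (p i : SuperFun U) = p i := by
  simp [p, parity_mk]

theorem parity_ξ (i : Fin n) : parity (ξ i : SuperFun U) = -ξ i := by
  rw [ξ, parity_mk, ← SuperFun.mk_neg_right]
  congr 1
  exact CliffordAlgebra.involute_ι _

theorem parity_θ (i : Fin n) : parity (θ i : SuperFun U) = -θ i := by
  rw [θ, parity_mk, ← SuperFun.mk_neg_right]
  congr 1
  exact CliffordAlgebra.involute_ι _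

theorem partialDeriv_one (i : Fin n) : Smooth.partialDeriv i (1 : Smooth U) = 0 := by
  have h := partialDeriv_mul i (1 : Smooth U) 1
  rw [mul_one, mul_one, one_mul] at h
  simpa using h

theorem dx_fn (i : Fin n) (f : Smooth U) : dx i (fn f) = fn (Smooth.partialDeriv i f) := rfl

theorem dx_p (i j : Fin n) : dx i (p j : SuperFun U) = 0 := by
  rw [p, dx_mk, partialDeriv_one, SuperFun.mk_zero_left]

theorem dx_ξ (i j : Fin n) : dx i (ξ j : SuperFun U) = 0 := by
  rw [ξ, dx_mk, partialDeriv_one, SuperFun.mk_zero_left]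

theorem dx_θ (i j : Fin n) : dx i (θ j : SuperFun U) = 0 := by
  rw [θ, dx_mk, partialDeriv_one, SuperFun.mk_zero_left]

theorem dp_fn (i : Fin n) (f : Smooth U) : dp i (fn f) = 0 := by
  rw [fn, dp_mk, Derivation.map_one_eq_zero, SuperFun.mk_zero_mid]

theorem dp_p (i j : Fin n) : dp i (p j : SuperFun U) = if i = j then 1 else 0 := by
  rw [p, dp_mk, MvPolynomial.pderiv_X, Pi.single_apply]
  split_ifs with h h' h'
  · rfl
  · exact absurd h.symm h'
  · exact absurd h'.symm h
  · exact SuperFun.mk_zero_mid _ _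

theorem dp_ξ (i j : Fin n) : dp i (ξ j : SuperFun U) = 0 := by
  rw [ξ, dp_mk, Derivation.map_one_eq_zero, SuperFun.mk_zero_mid]

theorem dp_θ (i j : Fin n) : dp i (θ j : SuperFun U) = 0 := by
  rw [θ, dp_mk, Derivation.map_one_eq_zero, SuperFun.mk_zero_mid]

theorem oddLeft_fn (a : Fin n ⊕ Fin n) (f : Smooth U) : oddLeft a (fn f) = 0 := by
  rw [fn, oddLeft_mk]
  erw [CliffordAlgebra.contractLeft_one]
  exact SuperFun.mk_zero_right _ _

theorem oddLeft_p (a : Fin n ⊕ Fin n) (i : Fin n) : oddLeft a (p i : SuperFun U) = 0 := by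
  rw [p, oddLeft_mk]
  erw [CliffordAlgebra.contractLeft_one]
  exact SuperFun.mk_zero_right _ _

theorem oddLeft_ι (a b : Fin n ⊕ Fin n) :
    oddLeft a (.mk 1 1 (ExteriorAlgebra.ι ℝ (Pi.single b 1)) : SuperFun U) =
      if a = b then 1 else 0 := by
  rw [oddLeft_mk]
  erw [CliffordAlgebra.contractLeft_ι]
  rw [LinearMap.proj_apply, Pi.single_apply]
  split_ifs
  · rw [map_one]; rfl
  · rw [map_zero]; exact SuperFun.mk_zero_right _ _

theorem oddLeft_inl_ξ (i j : Fin n) :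
    oddLeft (Sum.inl i) (ξ j : SuperFun U) = if i = j then 1 else 0 := by
  simp [ξ, oddLeft_ι]

theorem oddLeft_inr_ξ (i j : Fin n) : oddLeft (Sum.inr i) (ξ j : SuperFun U) = 0 := by
  simp [ξ, oddLeft_ι]

theorem oddLeft_inl_θ (i j : Fin n) : oddLeft (Sum.inl i) (θ j : SuperFun U) = 0 := by
  simp [θ, oddLeft_ι]

theorem oddLeft_inr_θ (i j : Fin n) :
    oddLeft (Sum.inr i) (θ j : SuperFun U) = if i = j then 1 else 0 := by
  simp [θ, oddLeft_ι]

end SuperAlgebra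

/-! ### The Poisson bracket and the Jacobi identity for an even multivector -/

section Jacobi

variable {n : ℕ} {U : TopologicalSpace.Opens (Eucl n)}

theorem bracket_eq (F G : SuperFun U) : bracket F G =
    ∑ i : Fin n, (dp i F * dx i G - dx i F * dp i G
      + parity (oddLeft (Sum.inl i) F) * oddLeft (Sum.inr i) G
      + parity (oddLeft (Sum.inr i) F) * oddLeft (Sum.inl i) G) := by
  simp only [bracket, oddRight_eq]

theorem bracket_add_left (F G H : SuperFun U) : bracket (F + G) H = bracket F H + bracket G H := by
  simp only [bracket_eq, map_add, add_mul, ← Finset.sum_add_distrib]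
  exact Finset.sum_congr rfl fun i _ => by abel

theorem bracket_add_right (F G H : SuperFun U) :
    bracket F (G + H) = bracket F G + bracket F H := by
  simp only [bracket_eq, map_add, mul_add, ← Finset.sum_add_distrib]
  exact Finset.sum_congr rfl fun i _ => by abel

theorem bracket_smul_left (r : ℝ) (F G : SuperFun U) : bracket (r • F) G = r • bracket F G := by
  simp only [bracket_eq, map_smul, smul_mul_assoc, Finset.smul_sum, smul_add, smul_sub]

theorem bracket_smul_right (r : ℝ) (F G : SuperFun U) : bracket F (r • G) = r • bracket F G := by
  simp only [bracket_eq, map_smul, mul_smul_comm, Finset.smul_sum, smul_add, smul_sub]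

theorem bracket_zero_left (F : SuperFun U) : bracket 0 F = 0 := by
  simpa using bracket_smul_left 0 0 F

theorem bracket_zero_right (F : SuperFun U) : bracket F 0 = 0 := by
  simpa using bracket_smul_right 0 F 0

/-- The bracket is even, so it is symmetric on odd functions: exchanging odd factors changes the
sign in the `x`, `p` terms, while the odd derivatives of odd functions are even and commute. -/
theorem bracket_comm_of_odd {F G : SuperFun U} (hF : parity F = -F) (hG : parity G = -G) :
    bracket F G = bracket G F := by
  simp only [bracket_eq]
  refine Finset.sum_congr rfl fun i _ => ?_
  have hL (a : Fin n ⊕ Fin n) {K : SuperFun U} (hK : parity K = -K) :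
      parity (oddLeft a K) = oddLeft a K := by rw [parity_oddLeft, hK, map_neg, neg_neg]
  have hx {K : SuperFun U} (hK : parity K = -K) : parity (dx i K) = -dx i K := by
    rw [parity_dx, hK, map_neg]
  have hp {K : SuperFun U} (hK : parity K = -K) : parity (dp i K) = -dp i K := by
    rw [parity_dp, hK, map_neg]
  rw [hL _ hF, hL _ hG, hL _ hF, hL _ hG, mul_odd (dp i F) (hx hG), mul_odd (dx i F) (hp hG),
    hx hF, hp hF, mul_even _ (hL (Sum.inr i) hG), mul_even _ (hL (Sum.inl i) hG)]
  noncomm_ring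

/-- An even function of the coordinates `x` and `θ` alone. -/
structure IsEvenMultivector (H : SuperFun U) : Prop where
  parity_eq : parity H = H
  dp_eq : ∀ i, dp i H = 0
  oddLeft_eq : ∀ i, oddLeft (Sum.inl i) H = 0

namespace IsEvenMultivector

variable {H : SuperFun U} (hH : IsEvenMultivector H)
include hH

theorem parity_dx (i : Fin n) : parity (dx i H) = dx i H := by
  rw [TwistedPoisson.parity_dx, hH.parity_eq]

theorem parity_oddLeft (a : Fin n ⊕ Fin n) : parity (oddLeft a H) = -oddLeft a H := by
  rw [TwistedPoisson.parity_oddLeft, hH.parity_eq]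

theorem bracket_apply (F : SuperFun U) : bracket H F =
    -∑ i : Fin n, (dx i H * dp i F + oddLeft (Sum.inr i) H * oddLeft (Sum.inl i) F) := by
  rw [bracket_eq, ← Finset.sum_neg_distrib]
  refine Finset.sum_congr rfl fun i _ => ?_
  rw [hH.dp_eq, hH.oddLeft_eq, hH.parity_oddLeft]
  simp only [map_zero, zero_mul, neg_mul]
  abel

/-- `{H, ·}` is a first-order operator whose coefficients are derivatives of `H`: the coefficient of
`∂/∂pᵢ` is even and that of `∂/∂ξⁱ` is odd. The sign from moving the odd coefficient past `F`
cancels the one in the graded Leibniz rule. -/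
theorem bracket_mul (F G : SuperFun U) :
    bracket H (F * G) = bracket H F * G + F * bracket H G := by
  simp only [hH.bracket_apply, neg_mul, mul_neg, Finset.sum_mul, Finset.mul_sum,
    ← Finset.sum_neg_distrib, ← Finset.sum_add_distrib]
  refine Finset.sum_congr rfl fun i _ => ?_
  rw [dp_mul, oddLeft_mul, mul_add F, ← mul_assoc F, mul_even F (hH.parity_dx i), ← mul_assoc F,
    mul_odd F (hH.parity_oddLeft (Sum.inr i))]
  noncomm_ring

theorem dp_bracket (j : Fin n) (F : SuperFun U) :
    dp j (bracket H F) = bracket H (dp j F) := by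
  simp only [hH.bracket_apply, map_neg, map_sum, map_add, dp_mul]
  congr 1
  refine Finset.sum_congr rfl fun i _ => ?_
  rw [← dx_dp, dp_oddLeft, dp_oddLeft, hH.dp_eq, dp_comm]
  simp

theorem inl_bracket (j : Fin n) (F : SuperFun U) :
    oddLeft (Sum.inl j) (bracket H F) = bracket H (oddLeft (Sum.inl j) F) := by
  simp only [hH.bracket_apply, map_neg, map_sum, map_add, oddLeft_mul]
  congr 1
  refine Finset.sum_congr rfl fun i _ => ?_
  rw [← dx_oddLeft, oddLeft_comm (Sum.inl j) (Sum.inr i), hH.oddLeft_eq, hH.parity_dx,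
    hH.parity_oddLeft, oddLeft_comm (Sum.inl j) (Sum.inl i), dp_oddLeft]
  simp

/-- `∂/∂p` and `∂/∂ξ` commute with `{H, ·}` because `H` involves neither variable. `∂/∂x` and `∂/∂θ`
also hit the coefficients, leaving terms with second derivatives of `H`, which must cancel in the
Jacobi identity. -/
theorem dx_bracket (j : Fin n) (F : SuperFun U) :
    dx j (bracket H F) = bracket H (dx j F) -
      ∑ i, (dx j (dx i H) * dp i F + dx j (oddLeft (Sum.inr i) H) * oddLeft (Sum.inl i) F) := by
  simp only [hH.bracket_apply, map_neg, map_sum, map_add, dx_mul, ← Finset.sum_neg_distrib,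
    ← Finset.sum_sub_distrib]
  refine Finset.sum_congr rfl fun i _ => ?_
  rw [dx_dp, dx_oddLeft j (Sum.inl i)]
  abel

theorem inr_bracket (j : Fin n) (F : SuperFun U) :
    oddLeft (Sum.inr j) (bracket H F) = bracket H (oddLeft (Sum.inr j) F) -
      ∑ i, (dx i (oddLeft (Sum.inr j) H) * dp i F +
        oddLeft (Sum.inr j) (oddLeft (Sum.inr i) H) * oddLeft (Sum.inl i) F) := by
  simp only [hH.bracket_apply, map_neg, map_sum, map_add, oddLeft_mul, ← Finset.sum_neg_distrib,
    ← Finset.sum_sub_distrib]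
  refine Finset.sum_congr rfl fun i _ => ?_
  rw [hH.parity_dx, hH.parity_oddLeft, oddLeft_comm (Sum.inr j) (Sum.inl i), dp_oddLeft,
    dx_oddLeft]
  noncomm_ring

theorem parity_bracket (F : SuperFun U) : parity (bracket H F) = bracket H (parity F) := by
  simp only [hH.bracket_apply, map_neg, map_sum, map_add, map_mul]
  congr 1
  refine Finset.sum_congr rfl fun i _ => ?_
  rw [hH.parity_dx, hH.parity_oddLeft, TwistedPoisson.parity_oddLeft, parity_dp, neg_mul_neg]

/-- The Jacobi identity for an even multivector: `{H, ·}` is a derivation of the bracket. -/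
theorem bracket_bracket (F G : SuperFun U) :
    bracket H (bracket F G) = bracket (bracket H F) G + bracket F (bracket H G) := by
  have hsum (f : Fin n → SuperFun U) : bracket H (∑ i, f i) = ∑ i, bracket H (f i) :=
    map_sum (AddMonoidHom.mk' (bracket H) (bracket_add_right H)) f Finset.univ
  have hsub (F G : SuperFun U) : bracket H (F - G) = bracket H F - bracket H G :=
    map_sub (AddMonoidHom.mk' (bracket H) (bracket_add_right H)) F G
  -- `S j i` collects second-derivative terms of `H` so that the failure of the Leibniz rule in the
  -- `j`-th summand is the sum over `i` of `S j i - S i j`, which cancels after summing over `j` as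
  -- well.
  set S : Fin n → Fin n → SuperFun U := fun j i =>
    dx j (dx i H) * dp j F * dp i G
      + dx j (oddLeft (Sum.inr i) H) * parity (dp j F) * oddLeft (Sum.inl i) G
      - dx j (oddLeft (Sum.inr i) H) * oddLeft (Sum.inl i) F * dp j G
      + oddLeft (Sum.inr j) (oddLeft (Sum.inr i) H) * parity (oddLeft (Sum.inl j) F)
        * oddLeft (Sum.inl i) G with hS
  have key : ∀ j, bracket H (dp j F * dx j G - dx j F * dp j G
      + parity (oddLeft (Sum.inl j) F) * oddLeft (Sum.inr j) G
      + parity (oddLeft (Sum.inr j) F) * oddLeft (Sum.inl j) G) =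
      (dp j (bracket H F) * dx j G - dx j (bracket H F) * dp j G
      + parity (oddLeft (Sum.inl j) (bracket H F)) * oddLeft (Sum.inr j) G
      + parity (oddLeft (Sum.inr j) (bracket H F)) * oddLeft (Sum.inl j) G) +
      (dp j F * dx j (bracket H G) - dx j F * dp j (bracket H G)
      + parity (oddLeft (Sum.inl j) F) * oddLeft (Sum.inr j) (bracket H G)
      + parity (oddLeft (Sum.inr j) F) * oddLeft (Sum.inl j) (bracket H G)) +
      ∑ i, (S j i - S i j) := by
    intro j
    have hT : ∑ i, (S j i - S i j) =
        dp j F * (∑ i, (dx j (dx i H) * dp i G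
            + dx j (oddLeft (Sum.inr i) H) * oddLeft (Sum.inl i) G))
        - (∑ i, (dx j (dx i H) * dp i F
            + dx j (oddLeft (Sum.inr i) H) * oddLeft (Sum.inl i) F)) * dp j G
        + parity (oddLeft (Sum.inl j) F) * (∑ i, (dx i (oddLeft (Sum.inr j) H) * dp i G
            + oddLeft (Sum.inr j) (oddLeft (Sum.inr i) H) * oddLeft (Sum.inl i) G))
        + parity (∑ i, (dx i (oddLeft (Sum.inr j) H) * dp i F
            + oddLeft (Sum.inr j) (oddLeft (Sum.inr i) H) * oddLeft (Sum.inl i) F))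
          * oddLeft (Sum.inl j) G := by
      simp only [Finset.mul_sum, Finset.sum_mul, map_sum, ← Finset.sum_add_distrib,
        ← Finset.sum_sub_distrib]
      refine Finset.sum_congr rfl fun i _ => ?_
      have hX : parity (dx j (dx i H)) = dx j (dx i H) := by
        rw [TwistedPoisson.parity_dx, hH.parity_dx]
      have hY (k l : Fin n) : parity (dx k (oddLeft (Sum.inr l) H)) =
          -dx k (oddLeft (Sum.inr l) H) := by
        rw [TwistedPoisson.parity_dx, hH.parity_oddLeft, map_neg]
      have hZ : parity (oddLeft (Sum.inr j) (oddLeft (Sum.inr i) H)) =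
          oddLeft (Sum.inr j) (oddLeft (Sum.inr i) H) := by
        rw [TwistedPoisson.parity_oddLeft, hH.parity_oddLeft, map_neg, neg_neg]
      simp only [hS, map_add, map_mul, mul_add, add_mul, hY, hZ, ← mul_assoc]
      rw [mul_even (dp j F) hX, mul_odd (dp j F) (hY j i),
        mul_odd (parity (oddLeft (Sum.inl j) F)) (hY i j), parity_parity,
        mul_even (parity (oddLeft (Sum.inl j) F)) hZ, dx_comm i j,
        oddLeft_comm (Sum.inr i) (Sum.inr j)]
      noncomm_ring
    rw [hT]
    simp only [bracket_add_right, hsub, hH.bracket_mul, ← hH.parity_bracket, hH.dp_bracket,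
      hH.dx_bracket, hH.inl_bracket, hH.inr_bracket, map_sub]
    noncomm_ring
  have hzero : ∑ j, ∑ i, (S j i - S i j) = 0 := by
    simp only [Finset.sum_sub_distrib]
    rw [Finset.sum_comm, sub_self]
  rw [bracket_eq F G, hsum, Finset.sum_congr rfl fun j _ => key j, Finset.sum_add_distrib,
    Finset.sum_add_distrib, hzero, add_zero, ← bracket_eq, ← bracket_eq]

end IsEvenMultivector

end Jacobi

/-! ### Components of the twisted structure equation -/

section TwistEquations

variable {n : ℕ} {U : TopologicalSpace.Opens (Eucl n)}

theorem bracket_sum_right {ι : Type*} (s : Finset ι) (F : SuperFun U) (f : ι → SuperFun U) :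
    bracket F (∑ i ∈ s, f i) = ∑ i ∈ s, bracket F (f i) :=
  map_sum (AddMonoidHom.mk' (bracket F) (bracket_add_right F)) f s

/-- The components of `½ {exp D (h + φ), exp D (h + φ)} = 0` for `D = {H, ·}`, when the component
of highest degree of `exp D (h + φ)` vanishes. -/
theorem IsEvenMultivector.twist_equations {H h φ h₁ h₂ φ₁ φ₂ φ₃ : SuperFun U}
    (hH : IsEvenMultivector H) (ph : parity h = -h) (pφ : parity φ = -φ)
    (eh₁ : bracket H h = h₁) (eh₂ : bracket H h₁ = h₂) (eh₃ : bracket H h₂ = 0)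
    (eφ₁ : bracket H φ = φ₁) (eφ₂ : bracket H φ₁ = φ₂) (eφ₃ : bracket H φ₂ = φ₃)
    (eφ₄ : bracket H φ₃ = 0) (hh : bracket h h = 0) (hφ : bracket h φ = 0)
    (φφ : bracket φ φ = 0) (top : (1 / 2 : ℝ) • h₂ + (1 / 6 : ℝ) • φ₃ = 0) :
    (1 / 2 : ℝ) • bracket (h + φ₁) (h + φ₁) + bracket (h₁ + (1 / 2 : ℝ) • φ₂) φ = 0 ∧
    bracket (h₁ + (1 / 2 : ℝ) • φ₂) (h₁ + (1 / 2 : ℝ) • φ₂) = 0 ∧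
    bracket (h + φ₁) (h₁ + (1 / 2 : ℝ) • φ₂) = 0 ∧
    bracket (h + φ₁) φ = 0 := by
  have odd {F G : SuperFun U} (e : bracket H F = G) (hF : parity F = -F) : parity G = -G := by
    rw [← e, hH.parity_bracket, hF, ← neg_one_smul ℝ F, bracket_smul_right, neg_one_smul]
  have ph₁ := odd eh₁ ph
  have ph₂ := odd eh₂ ph₁
  have pφ₁ := odd eφ₁ pφ
  have pφ₂ := odd eφ₂ pφ₁
  have pφ₃ := odd eφ₃ pφ₂
  have D (F : SuperFun U) (hF : F = 0) : bracket H F = 0 := by rw [hF, bracket_zero_right]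
  have cm {F G : SuperFun U} (hF : parity F = -F) (hG : parity G = -G) := bracket_comm_of_odd hF hG
  -- `ak`, `bk`, `ck` are `Dᵏ` applied to `{h, h} = 0`, `{h, φ} = 0`, `{φ, φ} = 0` and expanded by
  -- the Leibniz rule.
  have a1 := D _ hh
  simp only [hH.bracket_bracket, eh₁] at a1
  have a2 := D _ a1
  simp only [hH.bracket_bracket, bracket_add_right, eh₁, eh₂] at a2
  have b1 := D _ hφ
  simp only [hH.bracket_bracket, eh₁, eφ₁] at b1
  have b2 := D _ b1
  simp only [hH.bracket_bracket, bracket_add_right, eh₁, eh₂, eφ₁, eφ₂] at b2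
  have b3 := D _ b2
  simp only [hH.bracket_bracket, bracket_add_right, eh₁, eh₂, eh₃, eφ₁, eφ₂, eφ₃,
    bracket_zero_left] at b3
  have c1 := D _ φφ
  simp only [hH.bracket_bracket, eφ₁] at c1
  have c2 := D _ c1
  simp only [hH.bracket_bracket, bracket_add_right, eφ₁, eφ₂] at c2
  have c3 := D _ c2
  simp only [hH.bracket_bracket, bracket_add_right, eφ₁, eφ₂, eφ₃] at c3
  have c4 := D _ c3
  simp only [hH.bracket_bracket, bracket_add_right, eφ₁, eφ₂, eφ₃, eφ₄, bracket_zero_left,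
    bracket_zero_right] at c4
  -- The `t`s pair the vanishing top component `½ h₂ + ⅙ φ₃` with `φ`, `h` and `φ₁`; they remove the
  -- terms in which it occurs.
  have t0 : (1 / 2 : ℝ) • bracket h₂ φ + (1 / 6 : ℝ) • bracket φ₃ φ = 0 := by
    rw [← bracket_smul_left, ← bracket_smul_left, ← bracket_add_left, top, bracket_zero_left]
  have t1 : (1 / 2 : ℝ) • bracket h₂ h + (1 / 6 : ℝ) • bracket φ₃ h = 0 := by
    rw [← bracket_smul_left, ← bracket_smul_left, ← bracket_add_left, top, bracket_zero_left]
  have t2 : (1 / 2 : ℝ) • bracket h₂ φ₁ + (1 / 6 : ℝ) • bracket φ₃ φ₁ = 0 := by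
    rw [← bracket_smul_left, ← bracket_smul_left, ← bracket_add_left, top, bracket_zero_left]
  simp only [bracket_add_left, bracket_add_right, bracket_smul_left, bracket_smul_right]
  rw [cm ph ph₁] at a1
  rw [cm ph ph₂] at a2
  rw [cm ph pφ₃] at b3
  rw [cm pφ pφ₁] at c1
  rw [cm pφ pφ₂] at c2
  rw [cm pφ pφ₃, cm pφ₁ pφ₂] at c3
  rw [cm pφ₁ pφ₃] at c4
  rw [cm ph ph₁, cm pφ₁ ph, cm pφ₁ ph₁, cm pφ₂ ph₁, cm pφ₁ pφ₂]
  refine ⟨?_, ?_, ?_, ?_⟩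
  -- The coefficients are those of `exp D (½{h, h} + {h, φ} + ½{φ, φ})`: `Dᵏ` carries `1/k!`, with
  -- an extra ½ for the `a` and `c` identities. The second equation is taken twice, since the
  -- component contains `½ {γ, γ}`.
  · linear_combination (norm := module) (1 / 2 : ℝ) • hh + b1 + (1 / 4 : ℝ) • c2
  · linear_combination (norm := module) (1 / 2 : ℝ) • a2 + (1 / 3 : ℝ) • b3 + (1 / 24 : ℝ) • c4
      - (2 : ℝ) • t1 - (2 : ℝ) • t2
  · linear_combination (norm := module) (1 / 2 : ℝ) • a1 + (1 / 2 : ℝ) • b2 + (1 / 12 : ℝ) • c3 - t0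
  · linear_combination (norm := module) hφ + (1 / 2 : ℝ) • c1

end TwistEquations

/-! ### Tensor fields as functions, and the action of a bivector on generators -/

section Twist

variable {n : ℕ} {U : TopologicalSpace.Opens (Eucl n)}

theorem fn_mul (f g : Smooth U) : fn (f * g) = fn f * fn g := by
  simp [fn, SuperFun.mk_mul_mk]

theorem fn_add (f g : Smooth U) : fn (f + g) = fn f + fn g := SuperFun.mk_add_left _ _ _ _

theorem fn_smul (r : ℝ) (f : Smooth U) : fn (r • f) = r • fn f := rfl

theorem fn_one : fn (1 : Smooth U) = 1 := rfl

theorem fn_zero : fn (0 : Smooth U) = 0 := SuperFun.mk_zero_left _ _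

theorem fn_neg (f : Smooth U) : fn (-f) = -fn f := by
  rw [← neg_one_smul ℝ, fn_smul, neg_one_smul]

theorem fn_sum {ι : Type*} (s : Finset ι) (f : ι → Smooth U) :
    fn (∑ i ∈ s, f i) = ∑ i ∈ s, fn (f i) :=
  map_sum (AddMonoidHom.mk' (fn (U := U)) fn_add) f s

theorem mul_fn (F : SuperFun U) (f : Smooth U) : F * fn f = fn f * F :=
  mul_even F (parity_fn f)

theorem parity_list_prod (l : List (SuperFun U)) (hl : ∀ F ∈ l, parity F = -F) :
    parity l.prod = (-1) ^ l.length * l.prod := by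
  induction l with
  | nil => simp
  | cons F l ih =>
    rw [List.prod_cons, map_mul, hl F (by simp), ih fun G hG => hl G (by simp [hG]),
      List.length_cons, pow_succ]
    have h : Commute ((-1 : SuperFun U) ^ l.length) F := (Commute.neg_one_left F).pow_left _
    rw [neg_mul, ← mul_assoc, ← h.eq]
    noncomm_ring

/-- The function `(1/k!) P_I v^I` with coefficients `P_I ∈ C^∞(U)`, where `v^I` is the product
of the members `v^{i₁}, …, v^{iₖ}` of a family of functions. -/
def contracted (v : Fin n → SuperFun U) {k : ℕ} (P : (Fin k → Fin n) → Smooth U) : SuperFun U :=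
  ((k.factorial : ℝ)⁻¹) • ∑ I : Fin k → Fin n, fn (P I) * (List.ofFn fun a => v (I a)).prod

/-- The sums `f_{ijk} u^i v^j w^k`. -/
def triple (f : (Fin 3 → Fin n) → Smooth U) (u v w : Fin n → SuperFun U) : SuperFun U :=
  ∑ I : Fin 3 → Fin n, fn (f I) * (u (I 0) * (v (I 1) * w (I 2)))

theorem contracted_three (v : Fin n → SuperFun U) (P : (Fin 3 → Fin n) → Smooth U) :
    contracted v P = (1 / 6 : ℝ) • triple P v v v := by
  rw [contracted, triple]
  congr 1
  · norm_num [Nat.factorial]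
  · simp [List.ofFn_succ]

theorem contracted_two (v : Fin n → SuperFun U) (P : (Fin 2 → Fin n) → Smooth U) :
    contracted v P = (1 / 2 : ℝ) • ∑ I : Fin 2 → Fin n,
      fn (P I) * (v (I 0) * v (I 1)) := by
  rw [contracted]
  congr 1
  · norm_num [Nat.factorial]
  · simp [List.ofFn_succ]

/-- Functions which only depend on the coordinates `x` and `θ`. -/
structure IsMultivector (F : SuperFun U) : Prop where
  dp_eq : ∀ i, dp i F = 0
  oddLeft_eq : ∀ i, oddLeft (Sum.inl i) F = 0

theorem IsMultivector.fn (f : Smooth U) : IsMultivector (fn f) :=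
  ⟨fun i => dp_fn i f, fun _ => oddLeft_fn _ f⟩

theorem IsMultivector.θ (i : Fin n) : IsMultivector (θ i : SuperFun U) :=
  ⟨fun j => dp_θ j i, fun j => oddLeft_inl_θ j i⟩

theorem IsMultivector.one : IsMultivector (1 : SuperFun U) := IsMultivector.fn 1

theorem IsMultivector.mul {F G : SuperFun U} (hF : IsMultivector F) (hG : IsMultivector G) :
    IsMultivector (F * G) :=
  ⟨fun i => by rw [dp_mul, hF.dp_eq, hG.dp_eq]; simp,
    fun i => by rw [oddLeft_mul, hF.oddLeft_eq, hG.oddLeft_eq]; simp⟩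

theorem IsMultivector.sum {ι : Type*} (s : Finset ι) {F : ι → SuperFun U}
    (hF : ∀ i ∈ s, IsMultivector (F i)) : IsMultivector (∑ i ∈ s, F i) :=
  ⟨fun i => by rw [map_sum]; exact Finset.sum_eq_zero fun j hj => (hF j hj).dp_eq i,
    fun i => by rw [map_sum]; exact Finset.sum_eq_zero fun j hj => (hF j hj).oddLeft_eq i⟩

theorem IsMultivector.smul (r : ℝ) {F : SuperFun U} (hF : IsMultivector F) :
    IsMultivector (r • F) :=
  ⟨fun i => by rw [map_smul, hF.dp_eq, smul_zero],
    fun i => by rw [map_smul, hF.oddLeft_eq, smul_zero]⟩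

theorem IsMultivector.neg {F : SuperFun U} (hF : IsMultivector F) : IsMultivector (-F) := by
  simpa using hF.smul (-1)

theorem IsMultivector.list_prod (l : List (SuperFun U)) (hl : ∀ F ∈ l, IsMultivector F) :
    IsMultivector l.prod := by
  induction l with
  | nil => exact .one
  | cons F l ih =>
    rw [List.prod_cons]
    exact (hl F (by simp)).mul (ih fun G hG => hl G (by simp [hG]))

theorem IsMultivector.dx {F : SuperFun U} (hF : IsMultivector F) (i : Fin n) :
    IsMultivector (dx i F) :=
  ⟨fun j => by rw [← dx_dp, hF.dp_eq, map_zero],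
    fun j => by rw [← dx_oddLeft, hF.oddLeft_eq, map_zero]⟩

theorem IsMultivector.oddLeft {F : SuperFun U} (hF : IsMultivector F) (i : Fin n) :
    IsMultivector (oddLeft (Sum.inr i) F) :=
  ⟨fun j => by rw [dp_oddLeft, hF.dp_eq, map_zero],
    fun j => by rw [oddLeft_comm, hF.oddLeft_eq, map_zero, neg_zero]⟩

theorem IsMultivector.contracted {v : Fin n → SuperFun U} (hv : ∀ i, IsMultivector (v i)) {k : ℕ}
    (P : (Fin k → Fin n) → Smooth U) : IsMultivector (contracted v P) :=
  .smul _ (.sum _ fun I _ => (IsMultivector.fn _).mul (.list_prod _ (by simp [hv])))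

theorem parity_contracted {v : Fin n → SuperFun U} (hv : ∀ i, parity (v i) = -v i) {k : ℕ}
    (P : (Fin k → Fin n) → Smooth U) :
    parity (contracted v P) = (-1) ^ k * contracted v P := by
  rw [contracted, map_smul, map_sum, mul_smul_comm, Finset.mul_sum]
  congr 1
  refine Finset.sum_congr rfl fun I _ => ?_
  rw [map_mul, parity_fn, parity_list_prod _ (by simp [hv]), List.length_ofFn, ← mul_assoc,
    ← mul_assoc, mul_fn]

theorem isEvenMultivector_contracted (P : (Fin 2 → Fin n) → Smooth U) :
    IsEvenMultivector (contracted θ P) where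
  parity_eq := by rw [parity_contracted parity_θ]; simp
  dp_eq := (IsMultivector.contracted IsMultivector.θ P).dp_eq
  oddLeft_eq := (IsMultivector.contracted IsMultivector.θ P).oddLeft_eq

/-- Differentiating `θᵢθₗ` gives two sums with opposite signs, which antisymmetry of `P` makes
equal; together they cancel the factor ½. The right side is `-bʲ`, where `bʲ = {π, ξʲ}`. -/
theorem oddLeft_inr_bivector {P : (Fin 2 → Fin n) → Smooth U} (hP : ∀ i j, P ![i, j] = -P ![j, i])
    (j : Fin n) :
    oddLeft (Sum.inr j) (contracted θ P) = -∑ l, fn (P ![l, j]) * θ l := by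
  have hsum (F : (Fin 2 → Fin n) → SuperFun U) : ∑ I, F I = ∑ i, ∑ l, F ![i, l] := by
    rw [← Fintype.sum_prod_type', ← (finTwoArrowEquiv (Fin n)).symm.sum_comp]
    rfl
  rw [contracted_two, hsum, map_smul, map_sum]
  simp only [map_sum, oddLeft_mul, oddLeft_fn, oddLeft_inr_θ, parity_fn, parity_θ,
    Matrix.cons_val_zero, Matrix.cons_val_one, zero_mul, zero_add, mul_add, ite_mul, one_mul,
    mul_ite, mul_one, mul_zero, Finset.sum_add_distrib, Finset.sum_ite_irrel,
    Finset.sum_ite_eq, Finset.sum_const_zero, Finset.mem_univ, if_true]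
  have h (l : Fin n) : fn (P ![j, l]) * θ l = -(fn (P ![l, j]) * θ l) := by
    rw [hP, fn_neg, neg_mul]
  simp only [h, mul_neg, Finset.sum_neg_distrib]
  module

namespace IsEvenMultivector

variable {H : SuperFun U} (hH : IsEvenMultivector H)
include hH

theorem bracket_multivector {F : SuperFun U} (hF : IsMultivector F) : bracket H F = 0 := by
  rw [hH.bracket_apply]
  simp [hF.dp_eq, hF.oddLeft_eq]

theorem bracket_ξ (i : Fin n) : bracket H (ξ i) = -oddLeft (Sum.inr i) H := by
  rw [hH.bracket_apply]
  simp [dp_ξ, oddLeft_inl_ξ]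

theorem bracket_p (i : Fin n) : bracket H (p i) = -dx i H := by
  rw [hH.bracket_apply]
  simp [dp_p, oddLeft_p]

theorem isMultivector : IsMultivector H := ⟨hH.dp_eq, hH.oddLeft_eq⟩

theorem bracket_multivector_mul {F : SuperFun U} (hF : IsMultivector F) (G : SuperFun U) :
    bracket H (F * G) = F * bracket H G := by
  rw [hH.bracket_mul, hH.bracket_multivector hF, zero_mul, zero_add]

theorem bracket_deRhamHam : bracket H (deRhamHam U) =
    -∑ i, (oddLeft (Sum.inr i) H * p i + dx i H * ξ i) := by
  rw [deRhamHam, bracket_sum_right, ← Finset.sum_neg_distrib]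
  refine Finset.sum_congr rfl fun i _ => ?_
  rw [hH.bracket_mul, hH.bracket_ξ, hH.bracket_p, mul_neg, mul_even _ (hH.parity_dx i)]
  noncomm_ring

/-- The coefficients in `{H, h_d}` are multivectors, which `{H, ·}` kills, so the second bracket
acts only on the remaining `pᵢ` and `ξⁱ` and yields the two halves of the Schouten bracket. -/
theorem bracket_bracket_deRhamHam : bracket H (bracket H (deRhamHam U)) = -schouten H H := by
  rw [hH.bracket_deRhamHam, ← neg_one_smul ℝ, bracket_smul_right, bracket_sum_right, schouten,
    neg_one_smul, Finset.sum_congr rfl fun i _ => ?_]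
  rw [bracket_add_right, hH.bracket_multivector_mul (hH.isMultivector.oddLeft _),
    hH.bracket_multivector_mul (hH.isMultivector.dx _), hH.bracket_ξ, hH.bracket_p,
    oddRight_eq, hH.parity_oddLeft]
  noncomm_ring

theorem bracket_triple (f : (Fin 3 → Fin n) → Smooth U) (u v w : Fin n → SuperFun U) :
    bracket H (triple f u v w) =
      triple f (fun i => bracket H (u i)) v w + triple f u (fun i => bracket H (v i)) w +
        triple f u v (fun i => bracket H (w i)) := by
  simp only [triple]
  rw [bracket_sum_right, ← Finset.sum_add_distrib, ← Finset.sum_add_distrib]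
  refine Finset.sum_congr rfl fun i _ => ?_
  rw [hH.bracket_multivector_mul (.fn _), hH.bracket_mul, hH.bracket_mul, mul_add, mul_add, mul_add]
  abel

end IsEvenMultivector

end Twist

/-! ### Multiplicativity of the bidegree and projection onto multivectors -/

section Bidegree

variable {n : ℕ} {U : TopologicalSpace.Opens (Eucl n)}

theorem list_prod_mul_list_prod (l l' : List (SuperFun U)) (hl : ∀ F ∈ l, parity F = -F)
    (hl' : ∀ F ∈ l', parity F = -F) :
    l.prod * l'.prod = ((-1 : ℝ) ^ (l.length * l'.length)) • (l'.prod * l.prod) := by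
  have hpow (m : ℕ) (F : SuperFun U) : (-1 : SuperFun U) ^ m * F = ((-1 : ℝ) ^ m) • F := by
    rcases neg_one_pow_eq_or ℝ m with h | h <;> rcases Nat.even_or_odd m with e | e
    · simp [e]
    · rw [e.neg_one_pow] at h; norm_num at h
    · rw [e.neg_one_pow] at h; norm_num at h
    · simp [e.neg_one_pow]
  have h := parity_list_prod l hl
  have h' := parity_list_prod l' hl'
  rcases Nat.even_or_odd l'.length with e | e
  · rw [e.neg_one_pow, one_mul] at h'
    rw [mul_even _ h', (e.mul_left _).neg_one_pow, one_smul]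
  · rw [e.neg_one_pow, neg_one_mul] at h'
    rw [mul_odd _ h', h, hpow, mul_smul_comm, mul_comm l.length, pow_mul, e.neg_one_pow]

/-- A product of two normally ordered monomials is again one up to sign: the coefficients and the
`p` are even and move freely, and only passing the `θ` of the first factor across the `ξ` of the
second costs a sign. -/
theorem mul_mem_bidegree {k l k' l' m m' : ℕ} {F G : SuperFun U} (hF : F ∈ bidegree U k l)
    (hG : G ∈ bidegree U k' l') (hm : k + k' = m := by rfl) (hm' : l + l' = m' := by rfl) :
    F * G ∈ bidegree U m m' := by
  subst hm hm'
  have h := Submodule.mul_mem_mul hF hG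
  unfold bidegree at h
  rw [Submodule.span_mul_span] at h
  refine Submodule.span_le.2 ?_ h
  rintro _ ⟨_, ⟨f, P, I, J, hk, hl, rfl⟩, _, ⟨g, P', I', J', hk', hl', rfl⟩, rfl⟩
  have hcomm : (J.map (θ (U := U))).prod * (I'.map ξ).prod =
      ((-1 : ℝ) ^ (J.length * I'.length)) • ((I'.map ξ).prod * (J.map θ).prod) := by
    have := list_prod_mul_list_prod (J.map (θ (U := U))) (I'.map ξ)
      (by simp only [List.mem_map]; rintro _ ⟨i, _, rfl⟩; exact parity_θ i)
      (by simp only [List.mem_map]; rintro _ ⟨i, _, rfl⟩; exact parity_ξ i)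
    rwa [List.length_map, List.length_map] at this
  have hp : parity (P'.map (p (U := U))).prod = (P'.map p).prod := by
    rw [map_list_prod, List.map_map]
    congr 2
    exact funext fun i => parity_p i
  have key : (fn f * (P.map p).prod * (I.map ξ).prod * (J.map θ).prod) *
      (fn g * (P'.map p).prod * (I'.map ξ).prod * (J'.map θ).prod) =
      ((-1 : ℝ) ^ (J.length * I'.length)) •
        (fn (f * g) * ((P ++ P').map p).prod * ((I ++ I').map ξ).prod *
          ((J ++ J').map θ).prod) := by
    simp only [List.map_append, List.prod_append, fn_mul]
    calc _ = (fn f * (P.map p).prod * (I.map ξ).prod * (J.map θ).prod) * fn g *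
          (P'.map p).prod * ((I'.map ξ).prod * (J'.map θ).prod) := by simp only [mul_assoc]
      _ = fn f * (fn g * (P.map p).prod * ((I.map ξ).prod * (J.map θ).prod)) *
          (P'.map p).prod * ((I'.map ξ).prod * (J'.map θ).prod) := by
        rw [mul_fn]
        simp only [← mul_assoc]
        rw [mul_fn (fn f)]
      _ = fn f * fn g * (P.map p).prod * (P'.map p).prod * (I.map ξ).prod *
          ((J.map θ).prod * (I'.map ξ).prod) * (J'.map θ).prod := by
        have := mul_even ((I.map (ξ (U := U))).prod * (J.map θ).prod) hp
        simp only [mul_assoc] at this ⊢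
        rw [← mul_assoc (J.map θ).prod (P'.map p).prod, ← mul_assoc (I.map ξ).prod, this]
        simp only [mul_assoc]
      _ = _ := by
        rw [hcomm]
        simp only [mul_smul_comm, smul_mul_assoc, mul_assoc]
  simp only [key]
  refine Submodule.smul_mem _ _ (Submodule.subset_span
    ⟨f * g, P ++ P', I ++ I', J ++ J', ?_, ?_, rfl⟩)
  · simp only [List.length_append]; omega
  · simp only [List.length_append]; omega

theorem fn_mem_bidegree (f : Smooth U) : fn f ∈ bidegree U 0 0 :=
  Submodule.subset_span ⟨f, [], [], [], rfl, rfl, by simp⟩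

theorem p_mem_bidegree (i : Fin n) : p i ∈ bidegree U 1 1 :=
  Submodule.subset_span ⟨1, [i], [], [], rfl, rfl, by simp [fn_one]⟩

theorem ξ_mem_bidegree (i : Fin n) : ξ i ∈ bidegree U 0 1 :=
  Submodule.subset_span ⟨1, [], [i], [], rfl, rfl, by simp [fn_one]⟩

theorem θ_mem_bidegree (i : Fin n) : θ i ∈ bidegree U 1 0 :=
  Submodule.subset_span ⟨1, [], [], [i], rfl, rfl, by simp [fn_one]⟩

theorem triple_mem_bidegree {u v w : Fin n → SuperFun U} {k l k' l' k'' l'' m m' : ℕ}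
    (f : (Fin 3 → Fin n) → Smooth U)
    (hu : ∀ i, u i ∈ bidegree U k l) (hv : ∀ i, v i ∈ bidegree U k' l')
    (hw : ∀ i, w i ∈ bidegree U k'' l'') (hm : k + (k' + k'') = m := by rfl)
    (hm' : l + (l' + l'') = m' := by rfl) :
    triple f u v w ∈ bidegree U m m' := by
  refine Submodule.sum_mem _ fun I _ => ?_
  exact mul_mem_bidegree (fn_mem_bidegree (f I))
    (mul_mem_bidegree (hu (I 0)) (mul_mem_bidegree (hv (I 1)) (hw (I 2))) hm hm')
    (zero_add _) (zero_add _)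

/-! ### Restriction to multivectors -/

/-- The homomorphism which sets the coordinates `p` and `ξ` to zero. -/
def restrict : SuperFun U →ₐ[ℝ] SuperFun U :=
  (Algebra.TensorProduct.map (AlgHom.id ℝ (Smooth U))
    (Algebra.TensorProduct.map (MvPolynomial.aeval (0 : Fin n → MvPolynomial (Fin n) ℝ))
      (ExteriorAlgebra.map (LinearMap.pi (fun a : Fin n ⊕ Fin n =>
        Sum.elim (fun _ => 0) (fun i => LinearMap.proj (Sum.inr i)) a) :
        (Fin n ⊕ Fin n → ℝ) →ₗ[ℝ] (Fin n ⊕ Fin n → ℝ)))) :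
    Smooth U ⊗[ℝ] (MvPolynomial (Fin n) ℝ ⊗[ℝ] OddAlg n) →ₐ[ℝ]
      Smooth U ⊗[ℝ] (MvPolynomial (Fin n) ℝ ⊗[ℝ] OddAlg n))

theorem restrict_mk (f : Smooth U) (q : MvPolynomial (Fin n) ℝ) (w : OddAlg n) :
    restrict (.mk f q w) = .mk f
      (MvPolynomial.aeval (0 : Fin n → MvPolynomial (Fin n) ℝ) q)
      (ExteriorAlgebra.map (LinearMap.pi (fun a : Fin n ⊕ Fin n =>
        Sum.elim (fun _ => 0) (fun i => LinearMap.proj (Sum.inr i)) a)) w) := rfl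

theorem restrict_fn (f : Smooth U) : restrict (fn f) = fn f := by
  simp [fn, restrict_mk]

theorem restrict_p (i : Fin n) : restrict (p i : SuperFun U) = 0 := by
  simp [p, restrict_mk, SuperFun.mk_zero_mid]

theorem restrict_ξ (i : Fin n) : restrict (ξ i : SuperFun U) = 0 := by
  rw [ξ, restrict_mk, ExteriorAlgebra.map_apply_ι]
  have h : (LinearMap.pi (fun a : Fin n ⊕ Fin n =>
      Sum.elim (fun _ => 0) (fun i => LinearMap.proj (Sum.inr i)) a) :
      (Fin n ⊕ Fin n → ℝ) →ₗ[ℝ] (Fin n ⊕ Fin n → ℝ)) (Pi.single (Sum.inl i) 1) = 0 := by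
    ext a
    rcases a with a | a <;> simp
  rw [h, map_zero]
  exact SuperFun.mk_zero_right _ _

theorem restrict_θ (i : Fin n) : restrict (θ i : SuperFun U) = θ i := by
  rw [θ, restrict_mk, ExteriorAlgebra.map_apply_ι, map_one]
  congr 2
  ext a
  rcases a with a | a <;> simp [Pi.single_apply]

theorem restrict_contracted {k : ℕ} (P : (Fin k → Fin n) → Smooth U) :
    restrict (contracted θ P) = contracted θ P := by
  simp [contracted, restrict_fn, map_list_prod, List.map_ofFn, Function.comp_def, restrict_θ]

/-- A generating monomial of positive second degree contains some `p` or `ξ`. This isolates the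
bidegree `(k, 0)` part of a function without proving that the bidegree decomposition is direct. -/
theorem restrict_eq_zero {k l : ℕ} {F : SuperFun U} (hF : F ∈ bidegree U k (l + 1)) :
    restrict F = 0 := by
  suffices h : bidegree U k (l + 1) ≤ LinearMap.ker (restrict (U := U)).toLinearMap from h hF
  refine Submodule.span_le.2 ?_
  rintro _ ⟨f, P, I, J, -, hl, rfl⟩
  change restrict _ = 0
  rcases P with _ | ⟨i, P⟩
  · rcases I with _ | ⟨i, I⟩
    · simp at hl
    · simp [restrict_ξ]
  · simp [restrict_p]

end Bidegree

/-! ### Explicit form of the twist and the criterion in one chart -/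

section Twist

variable {n : ℕ} {U : TopologicalSpace.Opens (Eucl n)}

theorem dx_contracted {v : Fin n → SuperFun U} {i : Fin n} (hv : ∀ j, dx i (v j) = 0) {k : ℕ}
    (P : (Fin k → Fin n) → Smooth U) :
    dx i (contracted v P) = contracted v fun I => Smooth.partialDeriv i (P I) := by
  have hl (l : List (SuperFun U)) (h : ∀ F ∈ l, dx i F = 0) : dx i l.prod = 0 := by
    induction l with
    | nil => exact (dx_fn i 1).trans (by rw [partialDeriv_one, fn_zero])
    | cons F l ih =>
      rw [List.prod_cons, dx_mul, h F (by simp), ih fun G hG => h G (by simp [hG])]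
      simp
  rw [contracted, contracted, map_smul, map_sum]
  congr 1
  refine Finset.sum_congr rfl fun I _ => ?_
  rw [dx_mul, dx_fn, hl _ (by simp [hv]), mul_zero, add_zero]

theorem dp_contracted_ξ (i : Fin n) {k : ℕ} (P : (Fin k → Fin n) → Smooth U) :
    dp i (contracted ξ P) = 0 := by
  have hl (l : List (SuperFun U)) (h : ∀ F ∈ l, dp i F = 0) : dp i l.prod = 0 := by
    induction l with
    | nil => exact dp_fn i 1
    | cons F l ih =>
      rw [List.prod_cons, dp_mul, h F (by simp), ih fun G hG => h G (by simp [hG])]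
      simp
  rw [contracted, map_smul, map_sum, Finset.sum_eq_zero fun I _ => ?_, smul_zero]
  rw [dp_mul, dp_fn, hl _ (by simp [dp_ξ])]
  simp

theorem oddLeft_contracted_ξ (i : Fin n) {k : ℕ} (P : (Fin k → Fin n) → Smooth U) :
    oddLeft (Sum.inr i) (contracted ξ P) = 0 := by
  have hl (l : List (SuperFun U)) (h : ∀ F ∈ l, oddLeft (Sum.inr i) F = 0) :
      oddLeft (Sum.inr i) l.prod = 0 := by
    induction l with
    | nil => exact oddLeft_fn _ 1
    | cons F l ih =>
      rw [List.prod_cons, oddLeft_mul, h F (by simp), ih fun G hG => h G (by simp [hG])]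
      simp
  rw [contracted, map_smul, map_sum, Finset.sum_eq_zero fun I _ => ?_, smul_zero]
  rw [oddLeft_mul, oddLeft_fn, hl _ (by simp [oddLeft_inr_ξ])]
  simp

theorem bracket_deRhamHam_self : bracket (deRhamHam U) (deRhamHam U) = 0 := by
  have hx (i : Fin n) : dx i (deRhamHam U) = 0 := by
    simp [deRhamHam, dx_mul, dx_ξ, dx_p]
  have hθ (i : Fin n) : oddLeft (Sum.inr i) (deRhamHam U) = 0 := by
    simp [deRhamHam, oddLeft_mul, oddLeft_inr_ξ, oddLeft_p]
  simp [bracket_eq, hx, hθ]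

theorem parity_deRhamHam : parity (deRhamHam U) = -deRhamHam U := by
  simp [deRhamHam, parity_ξ, parity_p]

/-- `h_d` has no `x` or `θ`, the form has no `p` or `θ`, and `∂h_d/∂pᵢ = ξⁱ`; a single family of
terms survives, the de Rham vector field applied to the form. -/
theorem bracket_deRhamHam_form {k : ℕ} (P : (Fin k → Fin n) → Smooth U) :
    bracket (deRhamHam U) (contracted ξ P) = ∑ i, ξ i * dx i (contracted ξ P) := by
  have hx (i : Fin n) : dx i (deRhamHam U) = 0 := by
    simp [deRhamHam, dx_mul, dx_ξ, dx_p]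
  have hθ (i : Fin n) : oddLeft (Sum.inr i) (deRhamHam U) = 0 := by
    simp [deRhamHam, oddLeft_mul, oddLeft_inr_ξ, oddLeft_p]
  have hp (i : Fin n) : dp i (deRhamHam U) = ξ i := by
    simp [deRhamHam, dp_mul, dp_ξ, dp_p]
  simp [bracket_eq, hx, hθ, hp, oddLeft_contracted_ξ]

theorem bracket_form_form {k l : ℕ} (P : (Fin k → Fin n) → Smooth U)
    (Q : (Fin l → Fin n) → Smooth U) : bracket (contracted ξ P) (contracted ξ Q) = 0 := by
  simp [bracket_eq, dp_contracted_ξ, oddLeft_contracted_ξ]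

theorem expHam_eq {H F : SuperFun U}
    (h : bracket H (bracket H (bracket H (bracket H F))) = 0) :
    expHam H F = F + bracket H F + (1 / 2 : ℝ) • bracket H (bracket H F) +
      (1 / 6 : ℝ) • bracket H (bracket H (bracket H F)) := by
  have hk (k : ℕ) : (bracket H)^[k + 4] F = 0 := by
    induction k with
    | zero => exact h
    | succ k ih => rw [Nat.add_right_comm, Function.iterate_succ_apply', ih, bracket_zero_right]
  -- All iterates from the fourth on vanish, so the series is its partial sum over `k < 4`.
  rw [expHam, finsum_eq_sum_of_support_subset (s := Finset.range 4)]
  · simp [Finset.sum_range_succ, Nat.factorial]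
  · intro k hk'
    by_contra hlt
    have hlt : 4 ≤ k := by simpa using hlt
    apply hk'
    obtain ⟨m, rfl⟩ := Nat.exists_eq_add_of_le' hlt
    change _ • (bracket H)^[m + 4] F = 0
    rw [hk, smul_zero]

theorem triple_zero_left (f : (Fin 3 → Fin n) → Smooth U) (v w : Fin n → SuperFun U) :
    triple f (fun _ => 0) v w = 0 := by simp [triple]

theorem triple_zero_mid (f : (Fin 3 → Fin n) → Smooth U) (u w : Fin n → SuperFun U) :
    triple f u (fun _ => 0) w = 0 := by simp [triple]

theorem triple_zero_right (f : (Fin 3 → Fin n) → Smooth U) (u v : Fin n → SuperFun U) :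
    triple f u v (fun _ => 0) = 0 := by simp [triple]

section Iterates

variable {H : SuperFun U} (hH : IsEvenMultivector H) {b : Fin n → SuperFun U}
  (hbξ : ∀ j, bracket H (ξ j) = b j) (f : (Fin 3 → Fin n) → Smooth U)
include hH hbξ

theorem bracket_form : bracket H (contracted ξ f) =
    (1 / 6 : ℝ) • (triple f b ξ ξ + triple f ξ b ξ + triple f ξ ξ b) := by
  rw [contracted_three, bracket_smul_right, hH.bracket_triple]
  simp only [hbξ]

theorem bracket_bracket_form (hbM : ∀ j, IsMultivector (b j)) :
    bracket H (bracket H (contracted ξ f)) =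
      (1 / 3 : ℝ) • (triple f b b ξ + triple f b ξ b + triple f ξ b b) := by
  have hbb (j : Fin n) : bracket H (b j) = 0 := hH.bracket_multivector (hbM j)
  rw [bracket_form hH hbξ, bracket_smul_right, bracket_add_right, bracket_add_right,
    hH.bracket_triple, hH.bracket_triple, hH.bracket_triple]
  simp only [hbξ, hbb, triple_zero_left, triple_zero_mid, triple_zero_right]
  module

/-- Each application of `D` replaces one `ξ` by `b` and kills the `b` already present. The three `ξ`
can be replaced in `3!` orders, which cancels the factor `1/6` of the form. -/
theorem bracket_bracket_bracket_form (hbM : ∀ j, IsMultivector (b j)) :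
    bracket H (bracket H (bracket H (contracted ξ f))) = triple f b b b := by
  have hbb (j : Fin n) : bracket H (b j) = 0 := hH.bracket_multivector (hbM j)
  rw [bracket_bracket_form hH hbξ f hbM, bracket_smul_right, bracket_add_right, bracket_add_right,
    hH.bracket_triple, hH.bracket_triple, hH.bracket_triple]
  simp only [hbξ, hbb, triple_zero_left, triple_zero_mid, triple_zero_right]
  module

theorem twist_middle_mem (hbM : ∀ j, IsMultivector (b j)) (hb : ∀ j, b j ∈ bidegree U 1 0)
    (hx : ∀ i, dx i H ∈ bidegree U 2 0) :
    deRhamHam U + bracket H (contracted ξ f) ∈ bidegree U 1 2 ∧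
    bracket H (deRhamHam U) + (1 / 2 : ℝ) • bracket H (bracket H (contracted ξ f)) ∈
      bidegree U 2 1 := by
  constructor
  · have t0 : deRhamHam U ∈ bidegree U 1 2 := by
      rw [deRhamHam]
      exact Submodule.sum_mem _ fun i _ => mul_mem_bidegree (ξ_mem_bidegree i) (p_mem_bidegree i)
    have t1 : triple f b ξ ξ ∈ bidegree U 1 2 :=
      triple_mem_bidegree f hb ξ_mem_bidegree ξ_mem_bidegree
    have t2 : triple f ξ b ξ ∈ bidegree U 1 2 :=
      triple_mem_bidegree f ξ_mem_bidegree hb ξ_mem_bidegree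
    have t3 : triple f ξ ξ b ∈ bidegree U 1 2 :=
      triple_mem_bidegree f ξ_mem_bidegree ξ_mem_bidegree hb
    rw [bracket_form hH hbξ f]
    exact Submodule.add_mem _ t0
      (Submodule.smul_mem _ _ (Submodule.add_mem _ (Submodule.add_mem _ t1 t2) t3))
  · have t0 : bracket H (deRhamHam U) ∈ bidegree U 2 1 := by
      rw [hH.bracket_deRhamHam, ← Finset.sum_neg_distrib]
      refine Submodule.sum_mem _ fun i _ => ?_
      have s1 : b i * p i ∈ bidegree U 2 1 := mul_mem_bidegree (hb i) (p_mem_bidegree i)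
      have s2 : dx i H * ξ i ∈ bidegree U 2 1 := mul_mem_bidegree (hx i) (ξ_mem_bidegree i)
      have e : -(oddLeft (Sum.inr i) H * p i + dx i H * ξ i) = b i * p i - dx i H * ξ i := by
        rw [← hbξ, hH.bracket_ξ]
        noncomm_ring
      rw [e]
      exact Submodule.sub_mem _ s1 s2
    have t1 : triple f b b ξ ∈ bidegree U 2 1 := triple_mem_bidegree f hb hb ξ_mem_bidegree
    have t2 : triple f b ξ b ∈ bidegree U 2 1 := triple_mem_bidegree f hb ξ_mem_bidegree hb
    have t3 : triple f ξ b b ∈ bidegree U 2 1 := triple_mem_bidegree f ξ_mem_bidegree hb hb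
    rw [bracket_bracket_form hH hbξ f hbM]
    exact Submodule.add_mem _ t0 (Submodule.smul_mem _ _
      (Submodule.smul_mem _ _ (Submodule.add_mem _ (Submodule.add_mem _ t1 t2) t3)))

theorem expHam_deRhamHam_add_form (hbM : ∀ j, IsMultivector (b j)) :
    expHam H (deRhamHam U + contracted ξ f) =
      (deRhamHam U + bracket H (contracted ξ f)) +
      (bracket H (deRhamHam U) + (1 / 2 : ℝ) • bracket H (bracket H (contracted ξ f))) +
      contracted ξ f + (contracted b f - (1 / 2 : ℝ) • schouten H H) ∧
    bracket H (bracket H (bracket H (deRhamHam U))) = 0 ∧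
    bracket H (bracket H (bracket H (bracket H (contracted ξ f)))) = 0 := by
  have φ3 := bracket_bracket_bracket_form hH hbξ f hbM
  have h2 := hH.bracket_bracket_deRhamHam
  have hbb (j : Fin n) : bracket H (b j) = 0 := hH.bracket_multivector (hbM j)
  have h3 : bracket H (bracket H (bracket H (deRhamHam U))) = 0 := by
    rw [h2]
    refine hH.bracket_multivector (.neg (.sum _ fun i _ => ?_))
    have hx := hH.isMultivector.dx i
    have hθ := hH.isMultivector.oddLeft i
    rw [oddRight_eq, hH.parity_oddLeft, sub_eq_add_neg]
    refine ⟨fun j => ?_, fun j => ?_⟩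
    · rw [map_add, map_neg, (hθ.neg.mul hx).dp_eq, (hx.mul hθ).dp_eq, neg_zero, add_zero]
    · rw [map_add, map_neg, (hθ.neg.mul hx).oddLeft_eq, (hx.mul hθ).oddLeft_eq, neg_zero, add_zero]
  have φ4 : bracket H (bracket H (bracket H (bracket H (contracted ξ f)))) = 0 := by
    rw [φ3, hH.bracket_triple]
    simp only [hbb, triple_zero_left, triple_zero_mid, triple_zero_right, add_zero]
  refine ⟨?_, h3, φ4⟩
  rw [expHam_eq]
  · simp only [bracket_add_right]
    rw [h3, φ3, h2, contracted_three b]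
    generalize triple f b b b = x, schouten H H = y
    module
  · simp only [bracket_add_right, h3, φ4, bracket_zero_right, add_zero]

end Iterates

/-- The quasi-Lie bialgebroid condition in one chart. -/
theorem twist_isQuasi_iff {P : (Fin 2 → Fin n) → Smooth U} (hP : ∀ i j, P ![i, j] = -P ![j, i])
    (f : (Fin 3 → Fin n) → Smooth U)
    (hf : bracket (deRhamHam U) (contracted ξ f) = 0) :
    (∃ μ ∈ bidegree U 1 2, ∃ γ ∈ bidegree U 2 1, ∃ ψ ∈ bidegree U 0 3,
      expHam (contracted θ P) (deRhamHam U + contracted ξ f) = μ + γ + ψ ∧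
      (1 / 2 : ℝ) • bracket μ μ + bracket γ ψ = 0 ∧ bracket γ γ = 0 ∧
      bracket μ γ = 0 ∧ bracket μ ψ = 0) ↔
    (1 / 2 : ℝ) • schouten (contracted θ P) (contracted θ P) =
      contracted (fun j => ∑ l, fn (P ![l, j]) * θ l) f := by
  set H : SuperFun U := contracted θ P with hHdef
  have hH : IsEvenMultivector H := isEvenMultivector_contracted P
  set b : Fin n → SuperFun U := fun j => ∑ l, fn (P ![l, j]) * θ l with hb
  have hbL (j : Fin n) : oddLeft (Sum.inr j) H = -b j := oddLeft_inr_bivector hP j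
  have hbξ (j : Fin n) : bracket H (ξ j) = b j := by rw [hH.bracket_ξ, hbL, neg_neg]
  have hbM (j : Fin n) : IsMultivector (b j) :=
    .sum _ fun l _ => (IsMultivector.fn _).mul (.θ l)
  have hbdeg (j : Fin n) : b j ∈ bidegree U 1 0 :=
    Submodule.sum_mem _ fun l _ => 
      mul_mem_bidegree (fn_mem_bidegree (P ![l, j])) (θ_mem_bidegree l)
  have hdx (i : Fin n) : dx i H = contracted θ fun I => Smooth.partialDeriv i (P I) :=
    dx_contracted (fun j => dx_θ i j) P
  have hdxdeg (i : Fin n) : dx i H ∈ bidegree U 2 0 := by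
    rw [hdx, contracted_two]
    exact Submodule.smul_mem _ _ (Submodule.sum_mem _ fun I _ => 
      mul_mem_bidegree (fn_mem_bidegree (Smooth.partialDeriv i (P I)))
        (mul_mem_bidegree (m := 2) (m' := 0) (θ_mem_bidegree (I 0)) (θ_mem_bidegree (I 1))))
  -- In this form the Schouten square visibly involves only `x` and `θ`, so it is fixed by
  -- `restrict`.
  have hS : schouten H H = (2 : ℝ) • ∑ i, b i * dx i H := by
    rw [schouten, Finset.smul_sum]
    refine Finset.sum_congr rfl fun i _ => ?_
    rw [oddRight_eq, hH.parity_oddLeft, hbL, neg_neg, mul_neg, ← mul_even _ (hH.parity_dx i)]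
    module
  obtain ⟨hexp, h3, φ4⟩ := expHam_deRhamHam_add_form hH hbξ f hbM
  obtain ⟨hμ, hγ⟩ := twist_middle_mem hH hbξ f hbM hbdeg hdxdeg
  have hψ : contracted ξ f ∈ bidegree U 0 3 := by
    have t : triple f ξ ξ ξ ∈ bidegree U 0 3 :=
      triple_mem_bidegree f ξ_mem_bidegree ξ_mem_bidegree ξ_mem_bidegree
    rw [contracted_three]
    exact Submodule.smul_mem _ _ t
  constructor
  · rintro ⟨μ, hμ', γ, hγ', ψ, hψ', e, -⟩
    -- Setting `p = ξ = 0` annihilates the three components of the given decomposition and of the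
    -- explicit one alike, leaving `0` equal to the `(3, 0)` obstruction.
    have hr := congrArg restrict (hexp.symm.trans e)
    have hbr (j : Fin n) : restrict (b j) = b j := by
      simp [hb, restrict_fn, restrict_θ]
    have hcr : restrict (contracted b f) = contracted b f := by
      simp [contracted, restrict_fn, hbr]
    have hSr : restrict (schouten H H) = schouten H H := by
      rw [hS, map_smul, map_sum]
      simp only [map_mul, hbr, hdx, restrict_contracted]
    simp only [map_add, map_sub, restrict_eq_zero hμ', restrict_eq_zero hγ', restrict_eq_zero hψ',
      map_smul] at hr
    rw [← map_smul restrict, ← map_add restrict, ← map_add restrict, restrict_eq_zero hμ,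
      restrict_eq_zero hγ, restrict_eq_zero hψ, hcr, hSr] at hr
    simp only [add_zero, zero_add] at hr
    exact (sub_eq_zero.1 hr).symm
  · intro e
    -- The hypothesis says exactly that the `(3, 0)` component `½ D² h_d + ⅙ D³ φ` vanishes.
    have top : (1 / 2 : ℝ) • bracket H (bracket H (deRhamHam U)) +
        (1 / 6 : ℝ) • bracket H (bracket H (bracket H (contracted ξ f))) = 0 := by
      rw [hH.bracket_bracket_deRhamHam, bracket_bracket_bracket_form hH hbξ f hbM,
        ← contracted_three, ← e]
      module
    have pφ : parity (contracted ξ f) = -contracted ξ f := by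
      rw [parity_contracted parity_ξ]
      noncomm_ring
    obtain ⟨e1, e2, e3, e4⟩ := hH.twist_equations parity_deRhamHam pφ rfl rfl h3 rfl rfl rfl φ4
      bracket_deRhamHam_self hf (bracket_form_form f f) top
    refine ⟨_, hμ, _, hγ, _, hψ, ?_, e1, e2, e3, e4⟩
    rw [hexp, e, sub_self, add_zero]

end Twist

/-! ### Recovering components from functions, and the exterior derivative in components -/

section Coefficients

variable {n : ℕ} {U : TopologicalSpace.Opens (Eucl n)}

/-- The coefficient of a monomial in the odd coordinates, as a linear functional. -/
def oddCoeff {k : ℕ} (J : Fin k → Fin n ⊕ Fin n) : OddAlg n →ₗ[ℝ] ℝ :=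
  -- On degree `k` this is the alternating form `v ↦ det (v a (J b))`; the other degrees are sent to
  -- zero.
  ExteriorAlgebra.liftAlternating (Pi.single k
    (Matrix.detRowAlternating.compLinearMap (LinearMap.funLeft ℝ ℝ J)))

theorem oddCoeff_ιMulti {k : ℕ} (J : Fin k → Fin n ⊕ Fin n) (v : Fin k → Fin n ⊕ Fin n → ℝ) :
    oddCoeff J (ExteriorAlgebra.ιMulti ℝ k v) = Matrix.det (Matrix.of fun a b => v a (J b)) := by
  rw [oddCoeff, ExteriorAlgebra.liftAlternating_apply_ιMulti, Pi.single_eq_same]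
  rfl

/-- The coefficient of a monomial in the odd coordinates, at `p = 0`. -/
def coeff {k : ℕ} (J : Fin k → Fin n ⊕ Fin n) : SuperFun U →ₗ[ℝ] Smooth U :=
  ((TensorProduct.rid ℝ (Smooth U)).toLinearMap ∘ₗ LinearMap.lTensor (Smooth U)
    ((TensorProduct.lid ℝ ℝ).toLinearMap ∘ₗ TensorProduct.map
      (MvPolynomial.aeval (0 : Fin n → ℝ)).toLinearMap (oddCoeff J)) :
    Smooth U ⊗[ℝ] (MvPolynomial (Fin n) ℝ ⊗[ℝ] OddAlg n) →ₗ[ℝ] Smooth U)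

theorem coeff_mk {k : ℕ} (J : Fin k → Fin n ⊕ Fin n) (f : Smooth U) (w : OddAlg n) :
    coeff J (.mk f 1 w) = oddCoeff J w • f := by
  change (MvPolynomial.aeval (0 : Fin n → ℝ) 1 • oddCoeff J w) • f = _
  rw [map_one, one_smul]

/-- The odd coordinate with a given index. -/
def oddCoord (a : Fin n ⊕ Fin n) : SuperFun U := .mk 1 1 (ExteriorAlgebra.ι ℝ (Pi.single a 1))

theorem ofFn_mk_prod {k : ℕ} (v : Fin k → OddAlg n) :
    (List.ofFn fun a => (.mk 1 1 (v a) : SuperFun U)).prod = .mk 1 1 (List.ofFn v).prod := by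
  induction k with
  | zero => rfl
  | succ k ih =>
    simp only [List.ofFn_succ, List.prod_cons]
    rw [ih fun a => v a.succ, SuperFun.mk_mul_mk, mul_one, mul_one]

theorem ofFn_oddCoord_prod {k : ℕ} (J : Fin k → Fin n ⊕ Fin n) :
    (List.ofFn fun a => (oddCoord (J a) : SuperFun U)).prod =
      .mk 1 1 (ExteriorAlgebra.ιMulti ℝ k
        fun a => (Pi.single (J a) 1 : Fin n ⊕ Fin n → ℝ)) := by
  rw [ExteriorAlgebra.ιMulti_apply, ← ofFn_mk_prod]
  rfl

theorem fn_mul_mk (f : Smooth U) (w : OddAlg n) : fn f * .mk 1 1 w = .mk f 1 w := by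
  rw [fn, SuperFun.mk_mul_mk, mul_one, mul_one, one_mul]

/-- The monomial `I` contributes one determinant term for each permutation `σ` with `I ∘ σ = J`, and
antisymmetry turns its sign times `P I` into `P J`. Every `σ` is matched by exactly one `I`, so `P
J` is counted `k!` times, cancelling `1/k!`. -/
theorem coeff_contracted {s : Fin n → Fin n ⊕ Fin n} (hs : Function.Injective s) {k : ℕ}
    {P : (Fin k → Fin n) → Smooth U}
    (hP : ∀ (σ : Equiv.Perm (Fin k)) I, P (I ∘ σ) = Equiv.Perm.sign σ • P I) (J : Fin k → Fin n) :
    coeff (s ∘ J) (contracted (fun i => oddCoord (s i)) P) = P J := by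
  have hk : (k.factorial : ℝ) ≠ 0 := by positivity
  have hI (I : Fin k → Fin n) : coeff (s ∘ J) (fn (P I) *
      (List.ofFn fun a => (oddCoord (s (I a)) : SuperFun U)).prod) =
      ∑ σ : Equiv.Perm (Fin k), if I ∘ σ = J then P J else 0 := by
    have h := ofFn_oddCoord_prod (U := U) (s ∘ I)
    simp only [Function.comp_apply] at h
    rw [h, fn_mul_mk, coeff_mk, oddCoeff_ιMulti, Matrix.det_apply, Finset.sum_smul]
    refine Finset.sum_congr rfl fun σ _ => ?_
    have hprod : ∏ i, Matrix.of (fun a b => (Pi.single (s (I a)) (1 : ℝ) : Fin n ⊕ Fin n → ℝ)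
        ((s ∘ J) b)) (σ i) i = if I ∘ σ = J then 1 else 0 := by
      split_ifs with hσ
      · refine Finset.prod_eq_one fun i _ => ?_
        simp [← hσ]
      · obtain ⟨i, hi⟩ := Function.ne_iff.1 hσ
        refine Finset.prod_eq_zero (Finset.mem_univ i) ?_
        simp only [Matrix.of_apply, Function.comp_apply]
        rw [Pi.single_eq_of_ne]
        exact fun h => hi (hs h).symm
    rw [hprod]
    split_ifs with hσ
    · rw [← hσ, hP]
      rcases Int.units_eq_one_or (Equiv.Perm.sign σ) with h | h <;> simp [h]
    · simp
  rw [contracted, map_smul, map_sum, Finset.sum_congr rfl fun I _ => hI I, Finset.sum_comm]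
  have hσ (σ : Equiv.Perm (Fin k)) :
      ∑ I : Fin k → Fin n, (if I ∘ σ = J then P J else 0) = P J := by
    rw [Finset.sum_eq_single (J ∘ σ.symm)]
    · rw [if_pos]
      ext a
      simp
    · intro I _ hI
      rw [if_neg]
      rintro rfl
      apply hI
      ext a
      simp
    · simp
  rw [Finset.sum_congr rfl fun σ _ => hσ σ, Finset.sum_const, Finset.card_univ,
    Fintype.card_perm, Fintype.card_fin, ← Nat.cast_smul_eq_nsmul ℝ, smul_smul,
    inv_mul_cancel₀ hk, one_smul]

theorem contracted_θ_inj {k : ℕ} {P Q : (Fin k → Fin n) → Smooth U}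
    (hP : ∀ (σ : Equiv.Perm (Fin k)) I, P (I ∘ σ) = Equiv.Perm.sign σ • P I)
    (hQ : ∀ (σ : Equiv.Perm (Fin k)) I, Q (I ∘ σ) = Equiv.Perm.sign σ • Q I) :
    contracted θ P = contracted θ Q ↔ P = Q := by
  refine ⟨fun h => funext fun J => ?_, fun h => by rw [h]⟩
  rw [← coeff_contracted Sum.inr_injective hP J, ← coeff_contracted Sum.inr_injective hQ J]
  exact congrArg _ h

theorem contracted_ξ_eq_zero {k : ℕ} {P : (Fin k → Fin n) → Smooth U}
    (hP : ∀ (σ : Equiv.Perm (Fin k)) I, P (I ∘ σ) = Equiv.Perm.sign σ • P I) :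
    contracted ξ P = 0 ↔ P = 0 := by
  refine ⟨fun h => funext fun J => ?_, fun h => ?_⟩
  · rw [← coeff_contracted Sum.inl_injective hP J]
    exact (congrArg _ h).trans (map_zero _)
  · simp [h, contracted, fn_zero]

/-- The components of the exterior derivative of the form with components `P`. -/
def extDerivComp {k : ℕ} (P : (Fin k → Fin n) → Smooth U) (I : Fin (k + 1) → Fin n) : Smooth U :=
  ∑ m, (-1 : ℝ) ^ m.val • Smooth.partialDeriv (I m) (P (m.removeNth I))

theorem ofFn_ξ_insertNth {k : ℕ} (m : Fin (k + 1)) (i : Fin n) (J : Fin k → Fin n) :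
    (List.ofFn fun a => (ξ (m.insertNth (α := fun _ => Fin n) i J a) : SuperFun U)).prod =
      (-1 : ℝ) ^ m.val • (ξ i * (List.ofFn fun a => (ξ (J a) : SuperFun U)).prod) := by
  have h1 := ofFn_oddCoord_prod (U := U)
    fun a => (Sum.inl (m.insertNth (α := fun _ => Fin n) i J a))
  have h2 := ofFn_oddCoord_prod (U := U) fun a => (Sum.inl (Fin.cons (α := fun _ => Fin n) i J a))
  have h3 : (fun a => (Pi.single (Sum.inl (m.insertNth (α := fun _ => Fin n) i J a)) 1 :
      Fin n ⊕ Fin n → ℝ)) =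
      m.insertNth (Pi.single (Sum.inl i) 1) fun a => Pi.single (Sum.inl (J a)) 1 := by
    ext1 a
    refine Fin.succAboveCases m ?_ (fun b => ?_) a <;> simp
  have h4 : (fun a => (Pi.single (Sum.inl (Fin.cons (α := fun _ => Fin n) i J a)) 1 :
      Fin n ⊕ Fin n → ℝ)) =
      Matrix.vecCons (Pi.single (Sum.inl i) 1) fun a => Pi.single (Sum.inl (J a)) 1 := by
    ext1 a
    refine Fin.cases ?_ (fun b => ?_) a <;> simp
  have h5 : (List.ofFn fun a => (ξ (Fin.cons (α := fun _ => Fin n) i J a) : SuperFun U)).prod =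
      ξ i * (List.ofFn fun a => (ξ (J a) : SuperFun U)).prod := by
    simp [List.ofFn_succ]
  rw [← h5]
  refine h1.trans (Eq.trans ?_ (congrArg _ h2.symm))
  rw [h3, h4, AlternatingMap.map_insertNth]
  rcases neg_one_pow_eq_or ℝ m.val with h | h <;> rcases Nat.even_or_odd m.val with e | e
  · simp [e]
  · rw [e.neg_one_pow] at h; norm_num at h
  · rw [e.neg_one_pow] at h; norm_num at h
  · simp [e.neg_one_pow, SuperFun.mk_neg_right]

/-- Moving the differentiating index from position `m` to the front costs `(-1)^m`, the sign already
present in the exterior derivative. All `k + 1` positions thus contribute equally, reducing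
`1/(k+1)!` to `1/k!`. -/
theorem contracted_extDerivComp {k : ℕ} (P : (Fin k → Fin n) → Smooth U) :
    ∑ i, ξ i * dx i (contracted ξ P) = contracted ξ (extDerivComp P) := by
  have hk : ((k + 1 : ℕ) : ℝ) ≠ 0 := by positivity
  have hm (m : Fin (k + 1)) : ∑ I : Fin (k + 1) → Fin n,
      (-1 : ℝ) ^ m.val • (fn (Smooth.partialDeriv (I m) (P (m.removeNth I))) *
        (List.ofFn fun a => (ξ (I a) : SuperFun U)).prod) =
      ∑ i, ∑ J, fn (Smooth.partialDeriv i (P J)) *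
        (ξ i * (List.ofFn fun a => (ξ (J a) : SuperFun U)).prod) := by
    rw [← Fintype.sum_prod_type', ← (Fin.insertNthEquiv (fun _ => Fin n) m).sum_comp]
    refine Finset.sum_congr rfl fun q _ => ?_
    have hr : m.removeNth (Fin.insertNthEquiv (fun _ => Fin n) m q) = q.2 :=
      Fin.removeNth_insertNth _ _ _
    rw [hr]
    simp only [Fin.insertNthEquiv_apply, Fin.insertNth_apply_same, ofFn_ξ_insertNth]
    rw [mul_smul_comm, smul_smul, ← mul_pow]
    simp
  have hR : contracted ξ (extDerivComp P) = (((k + 1).factorial : ℝ)⁻¹) •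
      ∑ m : Fin (k + 1), ∑ I : Fin (k + 1) → Fin n,
      (-1 : ℝ) ^ m.val • (fn (Smooth.partialDeriv (I m) (P (m.removeNth I))) *
        (List.ofFn fun a => (ξ (I a) : SuperFun U)).prod) := by
    rw [contracted, Finset.sum_comm]
    simp only [extDerivComp, fn_sum, fn_smul, Finset.sum_mul, smul_mul_assoc]
  rw [hR, Finset.sum_congr rfl fun m _ => hm m, Finset.sum_const, Finset.card_univ,
    Fintype.card_fin, ← Nat.cast_smul_eq_nsmul ℝ, smul_smul, Nat.factorial_succ, Nat.cast_mul,
    mul_inv_rev, mul_assoc, inv_mul_cancel₀ hk, mul_one, Finset.smul_sum]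
  refine Finset.sum_congr rfl fun i _ => ?_
  rw [dx_contracted (fun j => dx_ξ i j), contracted, mul_smul_comm, Finset.mul_sum]
  congr 1
  refine Finset.sum_congr rfl fun J _ => ?_
  rw [← mul_assoc, mul_fn, mul_assoc]

end Coefficients

/-! ### Components of the trivectors `½ [π, π]` and `∧³π̃φ` -/

section Trivector

variable {n : ℕ} {U : TopologicalSpace.Opens (Eucl n)}

theorem sum_fin_two_fun {A : Type*} [AddCommMonoid A] (F : (Fin 2 → Fin n) → A) :
    ∑ I, F I = ∑ i, ∑ j, F ![i, j] := by
  rw [← Fintype.sum_prod_type', ← (finTwoArrowEquiv (Fin n)).symm.sum_comp]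
  rfl

theorem sum_fin_three_fun {A : Type*} [AddCommMonoid A] (F : (Fin 3 → Fin n) → A) :
    ∑ I, F I = ∑ i, ∑ j, ∑ k, F ![i, j, k] := by
  rw [← (Fin.consEquiv (fun _ => Fin n)).sum_comp, Fintype.sum_prod_type]
  refine Finset.sum_congr rfl fun i _ => ?_
  rw [sum_fin_two_fun]
  rfl

/-- The components of `½ [π, π]`, where `π` has the components `P`. -/
def jacobiator (P : (Fin 2 → Fin n) → Smooth U) (K : Fin 3 → Fin n) : Smooth U :=
  ∑ i, (P ![K 0, i] * Smooth.partialDeriv i (P ![K 1, K 2]) +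
    P ![K 1, i] * Smooth.partialDeriv i (P ![K 2, K 0]) +
    P ![K 2, i] * Smooth.partialDeriv i (P ![K 0, K 1]))

/-- Transpositions generate the permutations, and each reverses the cyclic order of the three terms
while antisymmetry of `P` supplies the sign. Antisymmetry is what allows these components to be read
off from the function of `θ`. -/
theorem jacobiator_perm {P : (Fin 2 → Fin n) → Smooth U} (hP : ∀ i j, P ![i, j] = -P ![j, i])
    (σ : Equiv.Perm (Fin 3)) (K : Fin 3 → Fin n) :
    jacobiator P (K ∘ σ) = Equiv.Perm.sign σ • jacobiator P K := by
  induction σ using Equiv.Perm.swap_induction_on generalizing K with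
  | one => simp
  | swap_mul σ x y hxy ih =>
    have h : ∀ L : Fin 3 → Fin n, jacobiator P (L ∘ Equiv.swap x y) = -jacobiator P L := by
      intro L
      have h01 : jacobiator P (L ∘ Equiv.swap 0 1) = -jacobiator P L := by
        simp only [jacobiator, Function.comp_apply, ← Finset.sum_neg_distrib]
        refine Finset.sum_congr rfl fun i _ => ?_
        rw [show Equiv.swap (0 : Fin 3) 1 0 = 1 by decide,
          show Equiv.swap (0 : Fin 3) 1 1 = 0 by decide,
          show Equiv.swap (0 : Fin 3) 1 2 = 2 by decide, hP (L 0) (L 2), hP (L 2) (L 1),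
          hP (L 1) (L 0), map_neg, map_neg, map_neg]
        ring
      have h12 : jacobiator P (L ∘ Equiv.swap 1 2) = -jacobiator P L := by
        simp only [jacobiator, Function.comp_apply, ← Finset.sum_neg_distrib]
        refine Finset.sum_congr rfl fun i _ => ?_
        rw [show Equiv.swap (1 : Fin 3) 2 0 = 0 by decide,
          show Equiv.swap (1 : Fin 3) 2 1 = 2 by decide,
          show Equiv.swap (1 : Fin 3) 2 2 = 1 by decide, hP (L 0) (L 2), hP (L 2) (L 1),
          hP (L 1) (L 0), map_neg, map_neg, map_neg]
        ring
      have h02 : jacobiator P (L ∘ Equiv.swap 0 2) = -jacobiator P L := by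
        simp only [jacobiator, Function.comp_apply, ← Finset.sum_neg_distrib]
        refine Finset.sum_congr rfl fun i _ => ?_
        rw [show Equiv.swap (0 : Fin 3) 2 0 = 2 by decide,
          show Equiv.swap (0 : Fin 3) 2 1 = 1 by decide,
          show Equiv.swap (0 : Fin 3) 2 2 = 0 by decide, hP (L 0) (L 2), hP (L 2) (L 1),
          hP (L 1) (L 0), map_neg, map_neg, map_neg]
        ring
      fin_cases x <;> fin_cases y
      · exact absurd rfl hxy
      · exact h01
      · exact h02
      · rw [Equiv.swap_comm]; exact h01
      · exact absurd rfl hxy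
      · exact h12
      · rw [Equiv.swap_comm]; exact h02
      · rw [Equiv.swap_comm]; exact h12
      · exact absurd rfl hxy
    rw [Equiv.Perm.coe_mul, ← Function.comp_assoc, ih, h, map_mul, Equiv.Perm.sign_swap hxy]
    simp

theorem θ_mul_θ (i j : Fin n) : (θ i * θ j : SuperFun U) = -(θ j * θ i) := by
  rw [mul_odd _ (parity_θ j), parity_θ, mul_neg]

theorem θ_cycle (i j k : Fin n) : (θ i * (θ j * θ k) : SuperFun U) = θ j * (θ k * θ i) := by
  rw [← mul_assoc, θ_mul_θ i j, neg_mul, mul_assoc, θ_mul_θ i k, mul_neg, neg_neg]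

theorem schouten_self {P : (Fin 2 → Fin n) → Smooth U} (hP : ∀ i j, P ![i, j] = -P ![j, i]) :
    (1 / 2 : ℝ) • schouten (contracted θ P) (contracted θ P) =
      contracted θ (jacobiator P) := by
  have hH := isEvenMultivector_contracted P
  -- `T a b c` is `P^{ai} ∂ᵢP^{bc}`, the coefficient of `θ_a θ_b θ_c` produced directly by the
  -- bracket. It is not totally antisymmetric; the Jacobiator is its cyclic sum.
  set T : (Fin n → Fin n → Fin n → SuperFun U) := fun a b c =>
    ∑ i, fn (P ![a, i] * Smooth.partialDeriv i (P ![b, c])) with hT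
  have hL : (1 / 2 : ℝ) • schouten (contracted θ P) (contracted θ P) =
      (1 / 2 : ℝ) • ∑ a, ∑ b, ∑ c, T a b c * (θ a * (θ b * θ c)) := by
    have h1 : schouten (contracted θ P) (contracted θ P) =
        (2 : ℝ) • ∑ i, (∑ l, fn (P ![l, i]) * θ l) * dx i (contracted θ P) := by
      rw [schouten, Finset.smul_sum]
      refine Finset.sum_congr rfl fun i _ => ?_
      rw [oddRight_eq, hH.parity_oddLeft, oddLeft_inr_bivector hP, neg_neg, mul_neg,
        ← mul_even _ (hH.parity_dx i)]
      module
    rw [h1]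
    have h2 (i : Fin n) : (∑ l, fn (P ![l, i]) * θ l) * dx i (contracted θ P) =
        (1 / 2 : ℝ) • ∑ a, ∑ b, ∑ c,
          fn (P ![a, i] * Smooth.partialDeriv i (P ![b, c])) * (θ a * (θ b * θ c)) := by
      rw [dx_contracted (fun j => dx_θ i j), contracted_two, mul_smul_comm, sum_fin_two_fun,
        Finset.sum_mul]
      congr 1
      refine Finset.sum_congr rfl fun a _ => ?_
      rw [Finset.mul_sum]
      refine Finset.sum_congr rfl fun b _ => ?_
      rw [Finset.mul_sum]
      refine Finset.sum_congr rfl fun c _ => ?_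
      simp only [Matrix.cons_val_zero, Matrix.cons_val_one, fn_mul, mul_assoc]
      rw [← mul_assoc (θ a), mul_fn, mul_assoc]
    rw [Finset.sum_congr rfl fun i _ => h2 i, ← Finset.smul_sum, smul_smul, smul_smul]
    congr 1
    · norm_num
    · rw [Finset.sum_comm]
      refine Finset.sum_congr rfl fun a _ => ?_
      rw [Finset.sum_comm]
      refine Finset.sum_congr rfl fun b _ => ?_
      rw [Finset.sum_comm]
      refine Finset.sum_congr rfl fun c _ => ?_
      rw [hT, Finset.sum_mul]
  have hR : contracted θ (jacobiator P) = (1 / 6 : ℝ) • ∑ a, ∑ b, ∑ c,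
      (T a b c + T b c a + T c a b) * (θ a * (θ b * θ c)) := by
    rw [contracted_three, triple, sum_fin_three_fun]
    simp only [jacobiator, hT, fn_sum, fn_add, Finset.sum_add_distrib]
    rfl
  -- A cyclic rotation of three `θ` is even, so the three cyclic shifts of `T` have equal sums, and
  -- `3 · ⅙` matches the `½` on the left.
  rw [hL, hR]
  simp only [add_mul, Finset.sum_add_distrib]
  have c1 : ∑ a, ∑ b, ∑ c, T b c a * (θ a * (θ b * θ c)) =
      ∑ a, ∑ b, ∑ c, T a b c * (θ a * (θ b * θ c)) := by
    rw [Finset.sum_comm]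
    refine Finset.sum_congr rfl fun b _ => ?_
    rw [Finset.sum_comm]
    refine Finset.sum_congr rfl fun c _ => Finset.sum_congr rfl fun a _ => ?_
    rw [θ_cycle]
  have c2 : ∑ a, ∑ b, ∑ c, T c a b * (θ a * (θ b * θ c)) =
      ∑ a, ∑ b, ∑ c, T a b c * (θ a * (θ b * θ c)) := by
    rw [← c1, Finset.sum_comm]
    refine Finset.sum_congr rfl fun b _ => ?_
    rw [Finset.sum_comm]
    refine Finset.sum_congr rfl fun c _ => Finset.sum_congr rfl fun a _ => ?_
    rw [θ_cycle]
  rw [c1, c2]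
  module

/-- The components of the trivector obtained by raising the indices of a 3-form. -/
def raisedComp (P : (Fin 2 → Fin n) → Smooth U) (f : (Fin 3 → Fin n) → Smooth U)
    (K : Fin 3 → Fin n) : Smooth U :=
  ∑ r : Fin 3 → Fin n, (∏ a, P ![K a, r a]) * f r

/-- Expanding the product of the three sums and moving the even coefficients to the left collects
the coefficient of each `θ` monomial. The entries `P ![l, j]` are the components of `π̃(dxˡ)`, so
these are the raised components with no extra sign. -/
theorem contracted_raised (P : (Fin 2 → Fin n) → Smooth U) (f : (Fin 3 → Fin n) → Smooth U) :
    contracted (fun j => ∑ l, fn (P ![l, j]) * θ l) f = contracted θ (raisedComp P f) := by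
  rw [contracted_three, contracted_three, triple, triple]
  congr 1
  have h (I : Fin 3 → Fin n) : fn (f I) * ((∑ l, fn (P ![l, I 0]) * θ l) *
      ((∑ l, fn (P ![l, I 1]) * θ l) * (∑ l, fn (P ![l, I 2]) * θ l))) =
      ∑ K : Fin 3 → Fin n, fn ((∏ a, P ![K a, I a]) * f I) *
        (θ (K 0) * (θ (K 1) * θ (K 2))) := by
    have expand (A B C : Fin n → SuperFun U) :
        (∑ i, A i) * ((∑ j, B j) * ∑ k, C k) = ∑ i, ∑ j, ∑ k, A i * (B j * C k) := by
      rw [Finset.sum_mul]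
      refine Finset.sum_congr rfl fun i _ => ?_
      rw [Finset.sum_mul, Finset.mul_sum]
      refine Finset.sum_congr rfl fun j _ => ?_
      rw [Finset.mul_sum, Finset.mul_sum]
    rw [sum_fin_three_fun, expand, Finset.mul_sum]
    refine Finset.sum_congr rfl fun i _ => ?_
    rw [Finset.mul_sum]
    refine Finset.sum_congr rfl fun j _ => ?_
    rw [Finset.mul_sum]
    refine Finset.sum_congr rfl fun k _ => ?_
    rw [Fin.prod_univ_three, mul_comm _ (f I)]
    simp only [fn_mul, mul_assoc]
    change _ = fn (f I) * (fn (P ![i, I 0]) * (fn (P ![j, I 1]) * (fn (P ![k, I 2]) *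
      (θ i * (θ j * θ k)))))
    rw [← mul_assoc (θ i) (fn (P ![j, I 1])), mul_fn (θ i), mul_assoc (fn (P ![j, I 1])),
      ← mul_assoc (θ j) (fn (P ![k, I 2])), mul_fn (θ j), mul_assoc (fn (P ![k, I 2])),
      ← mul_assoc (θ i) (fn (P ![k, I 2])), mul_fn (θ i), mul_assoc (fn (P ![k, I 2]))]
  rw [Finset.sum_congr rfl fun I _ => h I, Finset.sum_comm]
  simp only [raisedComp, fn_sum, Finset.sum_mul]

end Trivector

/-! ### The Jacobiator of the bracket of functions in coordinates -/

section LocalJacobi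

variable {n : ℕ} {U : TopologicalSpace.Opens (Eucl n)}

/-- The bracket of functions `-π(df, dg)` on an open subset of `ℝⁿ`. -/
def localBracket (P : (Fin 2 → Fin n) → Smooth U) (F G : Smooth U) : Smooth U :=
  -∑ i, ∑ j, P ![i, j] * Smooth.partialDeriv i F * Smooth.partialDeriv j G

theorem sum_cycle {A : Type*} [AddCommMonoid A] (F : Fin n → Fin n → Fin n → A) :
    ∑ a, ∑ b, ∑ c, F b c a = ∑ a, ∑ b, ∑ c, F a b c := by
  rw [Finset.sum_comm]
  exact Finset.sum_congr rfl fun b _ => Finset.sum_comm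

theorem sum_pairs_comm {A : Type*} [AddCommMonoid A] (X : Fin n → Fin n → Fin n → Fin n → A) :
    ∑ k, ∑ l, ∑ i, ∑ j, X k l i j = ∑ k, ∑ l, ∑ i, ∑ j, X i j k l := by
  have h (Y : Fin n → Fin n → A) : ∑ i, ∑ j, Y i j = ∑ q : Fin n × Fin n, Y q.1 q.2 :=
    (Fintype.sum_prod_type' Y).symm
  simp only [h]
  exact Finset.sum_comm

/-- The Jacobiator of the bracket `-P_{ij} D_i F D_j G` defined by commuting derivations `D_i` and
an antisymmetric matrix `P`. -/
theorem derivation_jacobi {A : Type*} [CommRing A] (D : Fin n → A →+ A)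
    (leib : ∀ k x y, D k (x * y) = D k x * y + x * D k y)
    (comm : ∀ i j x, D i (D j x) = D j (D i x)) {P : Fin n → Fin n → A}
    (hP : ∀ i j, P i j = -P j i) {B : A → A → A}
    (hB : ∀ x y, B x y = -∑ i, ∑ j, P i j * D i x * D j y) (F G H : A) :
    B (B F G) H + B (B G H) F + B (B H F) G =
    -∑ a, ∑ b, ∑ c, (∑ k, (P a k * D k (P b c) + P b k * D k (P c a) + P c k * D k (P a b))) *
      D a F * D b G * D c H := by
  -- `S F G H` holds the terms with a second derivative on `F`, and `t` those with a derivative on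
  -- `P`.
  set S : A → A → A → A := fun F G H =>
    ∑ k, ∑ l, ∑ i, ∑ j, P k l * P i j * D k (D i F) * D j G * D l H with hS
  set t : Fin n → Fin n → Fin n → A := fun a b c => ∑ k, P k c * D k (P a b) with ht
  -- Exchanging the two index pairs and using commutativity of the derivations shows that `S` is
  -- symmetric in its last two arguments.
  have hsymm (F G H : A) : S F H G = S F G H := by
    simp only [hS]
    rw [sum_pairs_comm]
    refine Finset.sum_congr rfl fun k _ => Finset.sum_congr rfl fun l _ =>
      Finset.sum_congr rfl fun i _ => Finset.sum_congr rfl fun j _ => ?_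
    rw [comm i k]
    ring
  have hexp (F G H : A) : B (B F G) H =
      ∑ a, ∑ b, ∑ c, t a b c * D a F * D b G * D c H + S F G H - S G F H := by
    have hT : ∑ a, ∑ b, ∑ c, t a b c * D a F * D b G * D c H =
        ∑ k, ∑ l, ∑ i, ∑ j, P k l * D k (P i j) * D i F * D j G * D l H := by
      rw [sum_pairs_comm]
      simp only [ht, Finset.sum_mul]
      exact Finset.sum_congr rfl fun a _ => Finset.sum_congr rfl fun b _ => Finset.sum_comm
    have hS' : S G F H = ∑ k, ∑ l, ∑ i, ∑ j, P k l * P j i * D k (D j G) * D i F * D l H := by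
      simp only [hS]
      refine Finset.sum_congr rfl fun k _ => Finset.sum_congr rfl fun l _ => ?_
      exact Finset.sum_comm
    rw [hT, hS', hB]
    simp only [hS, hB, map_neg, map_sum, leib, Finset.sum_mul, Finset.mul_sum,
      ← Finset.sum_neg_distrib, ← Finset.sum_add_distrib, ← Finset.sum_sub_distrib]
    refine Finset.sum_congr rfl fun k _ => Finset.sum_congr rfl fun l _ =>
      Finset.sum_congr rfl fun i _ => Finset.sum_congr rfl fun j _ => ?_
    rw [hP j i]
    ring
  have hcyc : ∑ a, ∑ b, ∑ c, t a b c * D a G * D b H * D c F =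
      ∑ a, ∑ b, ∑ c, t b c a * D a F * D b G * D c H := by
    rw [← sum_cycle]
    refine Finset.sum_congr rfl fun a _ => Finset.sum_congr rfl fun b _ =>
      Finset.sum_congr rfl fun c _ => by ring
  have hcyc' : ∑ a, ∑ b, ∑ c, t a b c * D a H * D b F * D c G =
      ∑ a, ∑ b, ∑ c, t c a b * D a F * D b G * D c H := by
    rw [← sum_cycle, ← sum_cycle]
    refine Finset.sum_congr rfl fun a _ => Finset.sum_congr rfl fun b _ =>
      Finset.sum_congr rfl fun c _ => by ring
  have hJ (a b c : Fin n) : ∑ k, (P a k * D k (P b c) + P b k * D k (P c a) +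
      P c k * D k (P a b)) = -(t a b c + t b c a + t c a b) := by
    simp only [ht, ← Finset.sum_add_distrib, ← Finset.sum_neg_distrib]
    refine Finset.sum_congr rfl fun k _ => ?_
    rw [hP a k, hP b k, hP c k]
    ring
  -- Over the cyclic sum, symmetry of `S` cancels the six second-derivative contributions in pairs;
  -- only the derivatives of `P` remain.
  rw [hexp, hexp, hexp, hcyc, hcyc', hsymm G F H, hsymm H F G, hsymm F H G]
  simp only [hJ, neg_mul, Finset.sum_neg_distrib, neg_neg, add_mul, Finset.sum_add_distrib]
  ring

theorem localBracket_jacobi {P : (Fin 2 → Fin n) → Smooth U}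
    (hP : ∀ i j, P ![i, j] = -P ![j, i]) (F G H : Smooth U) :
    localBracket P (localBracket P F G) H + localBracket P (localBracket P G H) F +
      localBracket P (localBracket P H F) G =
    -∑ K : Fin 3 → Fin n, jacobiator P K * Smooth.partialDeriv (K 0) F *
      Smooth.partialDeriv (K 1) G * Smooth.partialDeriv (K 2) H := by
  rw [sum_fin_three_fun]
  exact derivation_jacobi
    (fun i => (Smooth.partialDeriv i : Smooth U →ₗ[ℝ] Smooth U).toAddMonoidHom)
    partialDeriv_mul partialDeriv_comm hP (fun _ _ => rfl) F G H

theorem Smooth.sum_apply {ι : Type*} (s : Finset ι) (f : ι → Smooth U) (y : U) :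
    (∑ i ∈ s, f i).1 y = ∑ i ∈ s, (f i).1 y :=
  map_sum (AddMonoidHom.mk' (fun f : Smooth U => f.1 y) fun _ _ => rfl) f s

end LocalJacobi

/-! ### From charts to the manifold: claims 1 and 2 -/

section Charts

variable {n : ℕ} {M : Type*} [TopologicalSpace M] [ChartedSpace (Eucl n) M]

/-- The components of a differential form in a chart. -/
def formComp {k : ℕ} (φ : DiffForm n M k) (c : Chart n M) (I : Fin k → Fin n) : Smooth c.dom :=
  Smooth.mk' c.dom (fun y => localForm φ.val c y fun a => stdVec (I a)) (φ.smooth_apply c _)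

/-- The components of a multivector field in a chart. -/
def vecComp {k : ℕ} (P : MultiVec n M k) (c : Chart n M) (I : Fin k → Fin n) : Smooth c.dom :=
  Smooth.mk' c.dom (localComp P.val c I) (P.smooth c I)

theorem ofForm_apply {k : ℕ} (φ : DiffForm n M k) (c : Chart n M) :
    ofForm φ c = contracted ξ (formComp φ c) := rfl

theorem vecComp_perm {k : ℕ} (P : MultiVec n M k) (c : Chart n M) (σ : Equiv.Perm (Fin k))
    (I : Fin k → Fin n) : vecComp P c (I ∘ σ) = Equiv.Perm.sign σ • vecComp P c I := by
  ext y
  have h := (P.val (c.pt y)).map_perm (fun a => c.coframe y (I a)) σ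
  refine h.trans ?_
  rcases Int.units_eq_one_or (Equiv.Perm.sign σ) with h | h <;> rw [h] <;> simp <;> rfl

theorem vecComp_swap (P : MultiVec n M 2) (c : Chart n M) (i j : Fin n) :
    vecComp P c ![i, j] = -vecComp P c ![j, i] := by
  have h := vecComp_perm P c (Equiv.swap 0 1) ![j, i]
  have e : ![j, i] ∘ Equiv.swap (0 : Fin 2) 1 = ![i, j] := by
    ext a; fin_cases a <;> simp
  rw [e, Equiv.Perm.sign_swap (by decide)] at h
  simpa using h

theorem partialDeriv_mk' {U : TopologicalSpace.Opens (Eucl n)} {f : Eucl n → ℝ}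
    (hf : ContDiffOn ℝ ∞ f U) (i : Fin n) (y : U) :
    (Smooth.partialDeriv i (Smooth.mk' U f hf)).1 y = fderiv ℝ f y (stdVec i) := by
  have he : extZero (Smooth.mk' U f hf).1 =ᶠ[nhds (y : Eucl n)] f := by
    filter_upwards [U.isOpen.mem_nhds y.2] with z hz
    exact extZero_of_mem _ hz
  change fderiv ℝ (extZero (Smooth.mk' U f hf).1) y (stdVec i) = _
  rw [he.fderiv_eq]

theorem extDerivComp_apply {k : ℕ} (φ : DiffForm n M k) (c : Chart n M) (I : Fin (k + 1) → Fin n)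
    (y : c.dom) : (extDerivComp (formComp φ c) I).1 y =
      extDeriv (localForm φ.val c) y fun a => stdVec (I a) := by
  have hd : DifferentiableAt ℝ (localForm φ.val c) y :=
    ((φ.smooth c).contDiffAt (c.dom.isOpen.mem_nhds y.2)).differentiableAt (by simp)
  rw [extDeriv_apply hd, extDerivComp]
  rw [Smooth.sum_apply]
  refine Finset.sum_congr rfl fun m _ => ?_
  change (-1 : ℝ) ^ m.val • (Smooth.partialDeriv (I m) (formComp φ c (m.removeNth I))).1 y = _
  rw [formComp, partialDeriv_mk']
  rcases neg_one_pow_eq_or ℝ m.val with h | h <;> rcases Nat.even_or_odd m.val with e | e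
  · simp [e]; rfl
  · rw [e.neg_one_pow] at h; norm_num at h
  · rw [e.neg_one_pow] at h; norm_num at h
  · simp [e.neg_one_pow]; rfl

theorem extDerivComp_eq_zero {k : ℕ} (φ : DiffForm n M k) (c : Chart n M) :
    extDerivComp (formComp φ c) = 0 ↔
      ∀ y ∈ c.dom, extDeriv (localForm φ.val c) y = 0 := by
  constructor
  · intro h y hy
    -- An alternating form is determined by its values on tuples of basis vectors.
    apply ContinuousAlternatingMap.toAlternatingMap_injective
    refine Module.Basis.ext_alternating (EuclideanSpace.basisFun (Fin n) ℝ).toBasis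
      fun I _ => ?_
    have h' := extDerivComp_apply φ c I ⟨y, hy⟩
    rw [h] at h'
    simpa using h'.symm
  · intro h
    ext I y
    rw [extDerivComp_apply, h y y.2]
    rfl

theorem extDerivComp_perm {k : ℕ} (φ : DiffForm n M k) (c : Chart n M)
    (σ : Equiv.Perm (Fin (k + 1))) (I : Fin (k + 1) → Fin n) :
    extDerivComp (formComp φ c) (I ∘ σ) =
      Equiv.Perm.sign σ • extDerivComp (formComp φ c) I := by
  ext y
  have h := (extDeriv (localForm φ.val c) y).toAlternatingMap.map_perm
    (fun a => stdVec (I a)) σ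
  rw [extDerivComp_apply]
  refine h.trans ?_
  rw [ContinuousAlternatingMap.coe_toAlternatingMap, ← extDerivComp_apply]
  rcases Int.units_eq_one_or (Equiv.Perm.sign σ) with h | h <;> rw [h] <;> simp

theorem bracket_deRhamHam_ofForm_eq_zero {k : ℕ} (φ : DiffForm n M k) (c : Chart n M) :
    bracket (deRhamHam c.dom) (ofForm φ c) = 0 ↔
      ∀ y ∈ c.dom, extDeriv (localForm φ.val c) y = 0 := by
  rw [ofForm_apply, bracket_deRhamHam_form, contracted_extDerivComp,
    contracted_ξ_eq_zero (extDerivComp_perm φ c), extDerivComp_eq_zero]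

theorem structureEq_iff (φ : DiffForm n M 3) :
    StructureEq (hd n M + ofForm φ) ↔ φ.IsClosed := by
  have hc (c : Chart n M) : poisson (hd n M + ofForm φ) (hd n M + ofForm φ) c =
      (2 : ℝ) • bracket (deRhamHam c.dom) (ofForm φ c) := by
    change bracket (deRhamHam c.dom + ofForm φ c) (deRhamHam c.dom + ofForm φ c) = _
    have pφ : parity (ofForm φ c) = -ofForm φ c := by
      rw [ofForm_apply, parity_contracted parity_ξ]
      noncomm_ring
    rw [bracket_add_left, bracket_add_right, bracket_add_right, bracket_deRhamHam_self,
      bracket_comm_of_odd pφ parity_deRhamHam]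
    rw [ofForm_apply, bracket_form_form]
    module
  rw [StructureEq, funext_iff]
  refine forall_congr' fun c => ?_
  rw [hc, ← bracket_deRhamHam_ofForm_eq_zero]
  exact smul_eq_zero_iff_right two_ne_zero

variable [IsManifold (𝓡 n) ∞ M]

/-- `π̃(dxⁱ)` has components `P ![i, l]` in the coordinate frame, so multilinearity of `φ` expands
the raised form into its components. -/
theorem vecComp_raise (π : MultiVec n M 2) (φ : DiffForm n M 3) (c : Chart n M) :
    vecComp (raise π φ) c = raisedComp (vecComp π c) (formComp φ c) := by
  ext I ⟨y, hy⟩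
  have h1 : (vecComp (raise π φ) c I).1 ⟨y, hy⟩ = localForm φ.val c y
      (fun a => ∑ l, localComp π.val c ![I a, l] y • stdVec l) := by
    change φ.val (c.pt y) (fun a => sharp π (c.pt y) (c.coframe y (I a))) =
      φ.val (c.pt y) (fun a => c.frame y (∑ l, localComp π.val c ![I a, l] y • stdVec l))
    congr 1
    ext1 a
    exact sharp_coframe π c hy (I a)
  rw [h1, ContinuousAlternatingMap.map_sum]
  rw [raisedComp, Smooth.sum_apply]
  refine Finset.sum_congr rfl fun r _ => ?_
  rw [ContinuousAlternatingMap.map_smul_univ, smul_eq_mul, Fin.prod_univ_three,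
    Fin.prod_univ_three]
  rfl

theorem isQuasiLieBialgebroid_iff (φ : DiffForm n M 3) (π : MultiVec n M 2) (hφ : φ.IsClosed) :
    IsQuasiLieBialgebroid (twist π (hd n M + ofForm φ)) ↔
      (1 / 2 : ℝ) • schoutenBracket (ofMultiVec π) (ofMultiVec π) = ofMultiVec (raise π φ) := by
  have hc (c : Chart n M) := twist_isQuasi_iff (vecComp_swap π c) (formComp φ c)
    ((bracket_deRhamHam_ofForm_eq_zero φ c).2 (hφ c))
  simp only [contracted_raised, ← vecComp_raise] at hc
  constructor
  · rintro ⟨μ, γ, ψ, hμ, hγ, hψ, e, e1, e2, e3, e4⟩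
    ext1 c
    exact (hc c).1 ⟨μ c, hμ c, γ c, hγ c, ψ c, hψ c, congrFun e c, congrFun e1 c, congrFun e2 c,
      congrFun e3 c, congrFun e4 c⟩
  · intro h
    -- A function on `ℰ` is a family of chart expressions, so the components may be chosen
    -- separately in each chart.
    choose μ hμ γ hγ ψ hψ e e1 e2 e3 e4 using fun c => (hc c).2 (congrFun h c)
    exact ⟨μ, γ, ψ, hμ, hγ, hψ, funext e, funext e1, funext e2, funext e3, funext e4⟩

theorem schouten_eq_raise_iff (φ : DiffForm n M 3) (π : MultiVec n M 2) :
    (1 / 2 : ℝ) • schoutenBracket (ofMultiVec π) (ofMultiVec π) = ofMultiVec (raise π φ) ↔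
      ∀ (c : Chart n M), jacobiator (vecComp π c) = vecComp (raise π φ) c := by
  rw [funext_iff]
  refine forall_congr' fun c => ?_
  change (1 / 2 : ℝ) • schouten (contracted θ (vecComp π c)) (contracted θ (vecComp π c)) =
    contracted θ (vecComp (raise π φ) c) ↔ _
  rw [schouten_self (vecComp_swap π c),
    contracted_θ_inj (jacobiator_perm (vecComp_swap π c)) (vecComp_perm _ c)]

end Charts

/-! ### The bracket of global functions: claim 3 -/

section Functions

variable {n : ℕ} {M : Type*} [TopologicalSpace M] [ChartedSpace (Eucl n) M]

theorem MultiVec.val_sum_coframe {k : ℕ} (Q : MultiVec n M k) (c : Chart n M) (y : Eucl n)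
    (a : Fin k → Fin n → ℝ) :
    Q.val (c.pt y) (fun m => ∑ i, a m i • c.coframe y i) =
      ∑ I : Fin k → Fin n, (∏ m, a m (I m)) * localComp Q.val c I y := by
  refine ((Q.val (c.pt y)).toMultilinearMap.map_sum fun m i => a m i • c.coframe y i).trans ?_
  refine Finset.sum_congr rfl fun I _ => ?_
  exact (Q.val (c.pt y)).toMultilinearMap.map_smul_univ (fun m => a m (I m))
    fun m => c.coframe y (I m)

theorem contDiffOn_comp_pt (f : C^∞⟮𝓡 n, M; 𝓘(ℝ, ℝ), ℝ⟯) (c : Chart n M) :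
    ContDiffOn ℝ ∞ (fun y => f (c.pt y)) c.dom := by
  have h : ContMDiffOn (𝓡 n) 𝓘(ℝ, ℝ) ∞ (f ∘ c.1.symm) c.1.target :=
    f.contMDiff.comp_contMDiffOn (contMDiffOn_symm_of_mem_maximalAtlas c.2)
  exact contMDiffOn_iff_contDiffOn.mp h

/-- The expression of a function in a chart. -/
def funComp (f : C^∞⟮𝓡 n, M; 𝓘(ℝ, ℝ), ℝ⟯) (c : Chart n M) : Smooth c.dom :=
  Smooth.mk' c.dom (fun y => f (c.pt y)) (contDiffOn_comp_pt f c)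

theorem ofFun_apply (f : C^∞⟮𝓡 n, M; 𝓘(ℝ, ℝ), ℝ⟯) (c : Chart n M) :
    ofFun f c = fn (funComp f c) := rfl

variable [IsManifold (𝓡 n) ∞ M]

theorem diff_frame (f : C^∞⟮𝓡 n, M; 𝓘(ℝ, ℝ), ℝ⟯) (c : Chart n M) {y : Eucl n} (hy : y ∈ c.dom)
    (v : Eucl n) : diff f (c.pt y) (c.frame y v) = fderiv ℝ (fun y => f (c.pt y)) y v := by
  have hf : MDifferentiableAt (𝓡 n) 𝓘(ℝ, ℝ) f (c.1.symm y) :=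
    f.contMDiff.mdifferentiableAt (by simp)
  have hc : MDifferentiableAt 𝓘(ℝ, Eucl n) (𝓡 n) c.1.symm y :=
    c.mdifferentiable.mdifferentiableAt_symm hy
  have h := mfderiv_comp y hf hc
  rw [mfderiv_eq_fderiv] at h
  exact (DFunLike.congr_fun h v).symm

theorem diff_eq_sum (f : C^∞⟮𝓡 n, M; 𝓘(ℝ, ℝ), ℝ⟯) (c : Chart n M) (y : c.dom) :
    diff f (c.pt y) = ∑ i, (Smooth.partialDeriv i (funComp f c)).1 y • c.coframe y i := by
  ext v
  conv_lhs => rw [← c.frame_coframe y.2 v]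
  rw [map_sum, LinearMap.sum_apply]
  refine Finset.sum_congr rfl fun i _ => ?_
  rw [map_smul, diff_frame f c y.2, funComp, partialDeriv_mk', LinearMap.smul_apply, smul_eq_mul,
    smul_eq_mul, mul_comm]

theorem funBracket_apply (π : MultiVec n M 2) (f g : C^∞⟮𝓡 n, M; 𝓘(ℝ, ℝ), ℝ⟯) (c : Chart n M)
    (y : c.dom) : funBracket π f g (c.pt y) =
      (localBracket (vecComp π c) (funComp f c) (funComp g c)).1 y := by
  have hv : ![diff f (c.pt y), diff g (c.pt y)] = fun m => ∑ i,
      (![fun i => (Smooth.partialDeriv i (funComp f c)).1 y,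
        fun i => (Smooth.partialDeriv i (funComp g c)).1 y] m i) • c.coframe y i := by
    ext1 m
    fin_cases m
    · exact diff_eq_sum f c y
    · exact diff_eq_sum g c y
  rw [funBracket, hv, MultiVec.val_sum_coframe, localBracket, sum_fin_two_fun]
  change _ = -(∑ i, ∑ j, vecComp π c ![i, j] * Smooth.partialDeriv i (funComp f c) *
    Smooth.partialDeriv j (funComp g c)).1 y
  congr 1
  simp only [Smooth.sum_apply]
  refine Finset.sum_congr rfl fun i _ => Finset.sum_congr rfl fun j _ => ?_
  rw [Fin.prod_univ_two, mul_comm, ← mul_assoc]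
  rfl

theorem exists_chart_pt (x : M) : ∃ (c : Chart n M) (y : c.dom), c.pt y = x :=
  ⟨⟨chartAt (Eucl n) x, IsManifold.chart_mem_maximalAtlas x⟩,
    ⟨chartAt (Eucl n) x x, mem_chart_target _ x⟩,
    (chartAt (Eucl n) x).left_inv (mem_chart_source _ x)⟩

/-- Near each point the bracket is a local bracket of smooth expressions composed with a chart.
Smoothness makes the bracket an element of `C^∞(M)`, so that the coordinate formulas apply to
iterated brackets. -/
theorem contMDiff_funBracket (π : MultiVec n M 2) (f g : C^∞⟮𝓡 n, M; 𝓘(ℝ, ℝ), ℝ⟯) :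
    ContMDiff (𝓡 n) 𝓘(ℝ, ℝ) ∞ (funBracket π f g) := by
  intro x
  obtain ⟨c, y, rfl⟩ := exists_chart_pt (n := n) x
  have hs : c.pt y ∈ c.1.source := c.1.map_target y.2
  have h1 : ContDiffOn ℝ ∞ (fun z => funBracket π f g (c.pt z)) c.dom :=
    (localBracket (vecComp π c) (funComp f c) (funComp g c)).2.congr fun z hz => by
      rw [extZero_of_mem _ hz]
      exact funBracket_apply π f g c ⟨z, hz⟩
  have h2 : ContMDiffOn (𝓡 n) 𝓘(ℝ, ℝ) ∞ ((fun z => funBracket π f g (c.pt z)) ∘ c.1) c.1.source :=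
    (contMDiffOn_iff_contDiffOn.2 h1).comp (contMDiffOn_of_mem_maximalAtlas c.2)
      fun z hz => c.1.map_source hz
  refine ((h2.congr fun z hz => ?_).contMDiffAt (c.1.open_source.mem_nhds hs))
  simp only [Function.comp_apply]
  rw [Chart.pt, c.1.left_inv hz]

/-- The bracket of functions defined by a bivector field, as a smooth function. -/
def smoothBracket (π : MultiVec n M 2) (f g : C^∞⟮𝓡 n, M; 𝓘(ℝ, ℝ), ℝ⟯) :
    C^∞⟮𝓡 n, M; 𝓘(ℝ, ℝ), ℝ⟯ :=
  ⟨funBracket π f g, contMDiff_funBracket π f g⟩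

theorem funComp_smoothBracket (π : MultiVec n M 2) (f g : C^∞⟮𝓡 n, M; 𝓘(ℝ, ℝ), ℝ⟯)
    (c : Chart n M) : funComp (smoothBracket π f g) c =
      localBracket (vecComp π c) (funComp f c) (funComp g c) := by
  ext y
  exact funBracket_apply π f g c y

/-- `[F, π]` is a vector field linear in `θ`; its `θ_k` derivative reads off the `k`-th component,
which then differentiates `G`. Antisymmetry of `P` produces the overall minus sign. -/
theorem schouten_schouten_fn {U : TopologicalSpace.Opens (Eucl n)} {P : (Fin 2 → Fin n) → Smooth U}
    (hP : ∀ i j, P ![i, j] = -P ![j, i]) (F G : Smooth U) :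
    schouten (schouten (fn F) (contracted θ P)) (fn G) = fn (localBracket P F G) := by
  have h1 : schouten (fn F) (contracted θ P) =
      ∑ i, ∑ j, fn (Smooth.partialDeriv i F * P ![j, i]) * θ j := by
    rw [schouten]
    refine Finset.sum_congr rfl fun i _ => ?_
    rw [oddRight_eq, oddLeft_fn, map_zero, zero_mul, zero_sub, dx_fn, oddLeft_inr_bivector hP,
      mul_neg, neg_neg, Finset.mul_sum]
    exact Finset.sum_congr rfl fun j _ => by rw [fn_mul, mul_assoc]
  have h2 (k : Fin n) : oddRight (Sum.inr k) (schouten (fn F) (contracted θ P)) =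
      ∑ i, fn (Smooth.partialDeriv i F * P ![k, i]) := by
    rw [h1, map_sum]
    refine Finset.sum_congr rfl fun i _ => ?_
    rw [map_sum, Finset.sum_eq_single k]
    · rw [oddRight_eq, oddLeft_mul, oddLeft_fn, oddLeft_inr_θ, parity_fn]
      simp [parity_fn]
    · intro j _ hj
      rw [oddRight_eq, oddLeft_mul, oddLeft_fn, oddLeft_inr_θ, if_neg hj.symm]
      simp
    · simp
  rw [schouten]
  simp only [h2, oddLeft_fn, mul_zero, sub_zero, dx_fn, localBracket, ← fn_sum, ← fn_mul]
  congr 1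
  simp only [Finset.sum_mul]
  rw [Finset.sum_comm, ← Finset.sum_neg_distrib]
  refine Finset.sum_congr rfl fun i _ => ?_
  rw [← Finset.sum_neg_distrib]
  refine Finset.sum_congr rfl fun j _ => ?_
  rw [hP j i]
  ring

theorem ofFun_smoothBracket (π : MultiVec n M 2) (f g : C^∞⟮𝓡 n, M; 𝓘(ℝ, ℝ), ℝ⟯) :
    ofFun (smoothBracket π f g) =
      schoutenBracket (schoutenBracket (ofFun f) (ofMultiVec π)) (ofFun g) := by
  ext1 c
  rw [ofFun_apply, funComp_smoothBracket]
  exact (schouten_schouten_fn (vecComp_swap π c) _ _).symm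

theorem jacobi_apply (π : MultiVec n M 2) (f g h : C^∞⟮𝓡 n, M; 𝓘(ℝ, ℝ), ℝ⟯) (c : Chart n M)
    (y : c.dom) :
    funBracket π (funBracket π f g) h (c.pt y) + funBracket π (funBracket π g h) f (c.pt y) +
      funBracket π (funBracket π h f) g (c.pt y) =
    -∑ K : Fin 3 → Fin n, (jacobiator (vecComp π c) K).1 y *
      (Smooth.partialDeriv (K 0) (funComp f c)).1 y *
      (Smooth.partialDeriv (K 1) (funComp g c)).1 y *
      (Smooth.partialDeriv (K 2) (funComp h c)).1 y := by
  have e (f g h : C^∞⟮𝓡 n, M; 𝓘(ℝ, ℝ), ℝ⟯) :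
      funBracket π (funBracket π f g) h (c.pt y) = (localBracket (vecComp π c)
        (localBracket (vecComp π c) (funComp f c) (funComp g c)) (funComp h c)).1 y := by
    rw [← funComp_smoothBracket, ← funBracket_apply]
    rfl
  rw [e, e, e]
  have := congrArg (fun s : Smooth c.dom => s.1 y)
    (localBracket_jacobi (vecComp_swap π c) (funComp f c) (funComp g c) (funComp h c))
  refine this.trans ?_
  change -(∑ K : Fin 3 → Fin n, jacobiator (vecComp π c) K *
    Smooth.partialDeriv (K 0) (funComp f c) * Smooth.partialDeriv (K 1) (funComp g c) *
      Smooth.partialDeriv (K 2) (funComp h c)).1 y = _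
  rw [Smooth.sum_apply]
  rfl

theorem form_hamVec_apply (φ : DiffForm n M 3) (π : MultiVec n M 2)
    (f g h : C^∞⟮𝓡 n, M; 𝓘(ℝ, ℝ), ℝ⟯) (c : Chart n M) (y : c.dom) :
    φ.val (c.pt y) ![hamVec π f (c.pt y), hamVec π g (c.pt y), hamVec π h (c.pt y)] =
    -∑ K : Fin 3 → Fin n, (vecComp (raise π φ) c K).1 y *
      (Smooth.partialDeriv (K 0) (funComp f c)).1 y *
      (Smooth.partialDeriv (K 1) (funComp g c)).1 y *
      (Smooth.partialDeriv (K 2) (funComp h c)).1 y := by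
  -- Each of the three Hamiltonian vectors carries a factor `-1`, hence the total sign `(-1)³`.
  have h1 : φ.val (c.pt y) ![hamVec π f (c.pt y), hamVec π g (c.pt y), hamVec π h (c.pt y)] =
      -(raise π φ).val (c.pt y) ![diff f (c.pt y), diff g (c.pt y), diff h (c.pt y)] := by
    have e : ![hamVec π f (c.pt y), hamVec π g (c.pt y), hamVec π h (c.pt y)] =
        fun m => (-1 : ℝ) • sharp π (c.pt y)
          (![diff f (c.pt y), diff g (c.pt y), diff h (c.pt y)] m) := by
      ext1 m
      fin_cases m <;> simp [hamVec]
    rw [e]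
    refine ((φ.val (c.pt y)).toMultilinearMap.map_smul_univ (fun _ => (-1 : ℝ)) fun m =>
      sharp π (c.pt y) (![diff f (c.pt y), diff g (c.pt y), diff h (c.pt y)] m)).trans ?_
    rw [Fin.prod_univ_three]
    norm_num
    rfl
  have hv : ![diff f (c.pt y), diff g (c.pt y), diff h (c.pt y)] = fun m => ∑ i,
      (![fun i => (Smooth.partialDeriv i (funComp f c)).1 y,
        fun i => (Smooth.partialDeriv i (funComp g c)).1 y,
        fun i => (Smooth.partialDeriv i (funComp h c)).1 y] m i) • c.coframe y i := by
    ext1 m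
    fin_cases m
    · exact diff_eq_sum f c y
    · exact diff_eq_sum g c y
    · exact diff_eq_sum h c y
  rw [h1, hv, MultiVec.val_sum_coframe]
  congr 1
  refine Finset.sum_congr rfl fun K _ => ?_
  rw [Fin.prod_univ_three, mul_comm, ← mul_assoc, ← mul_assoc]
  rfl

/-- Every coordinate differential at a point is the differential of a global smooth function. -/
theorem exists_partialDeriv_eq [T2Space M] (c : Chart n M) (y : c.dom) (i : Fin n) :
    ∃ f : C^∞⟮𝓡 n, M; 𝓘(ℝ, ℝ), ℝ⟯, ∀ j,
      (Smooth.partialDeriv j (funComp f c)).1 y = if j = i then 1 else 0 := by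
  have hs : c.pt y ∈ c.1.source := c.1.map_target y.2
  -- In a Hausdorff manifold a bump function at the point can be chosen with closed support inside
  -- the chart domain; multiplied by the coordinate it is smooth on all of `M`.
  obtain ⟨ρ, -, hρ⟩ := (SmoothBumpFunction.nhds_basis_tsupport (I := 𝓡 n) (c.pt y)).mem_iff.1
    (c.1.open_source.mem_nhds hs)
  have hproj : ContMDiffOn (𝓡 n) 𝓘(ℝ, ℝ) ∞ (fun x => c.1 x i) c.1.source :=
    ((EuclideanSpace.proj (𝕜 := ℝ) i : Eucl n →L[ℝ] ℝ).contDiff.contMDiff.comp_contMDiffOn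
      (contMDiffOn_of_mem_maximalAtlas c.2))
  have hf : ContMDiff (𝓡 n) 𝓘(ℝ, ℝ) ∞ fun x => ρ x * c.1 x i := by
    refine contMDiff_of_tsupport fun x hx => ?_
    have hx' : x ∈ c.1.source := hρ (tsupport_mul_subset_left hx)
    exact ρ.contMDiffAt.mul (hproj.contMDiffAt (c.1.open_source.mem_nhds hx'))
  refine ⟨⟨_, hf⟩, fun j => ?_⟩
  refine (partialDeriv_mk' _ j y).trans ?_
  have hcont : ContinuousAt c.pt (y : Eucl n) := c.1.continuousAt_symm y.2
  -- Near the point `ρ = 1`, so there the global function is the coordinate itself and has the same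
  -- derivative.
  have he : (fun z => ρ (c.pt z) * c.1 (c.pt z) i) =ᶠ[nhds (y : Eucl n)]
      (EuclideanSpace.proj (𝕜 := ℝ) i : Eucl n →L[ℝ] ℝ) := by
    filter_upwards [hcont.eventually ρ.eventuallyEq_one, c.dom.isOpen.mem_nhds y.2] with z h1 h2
    have h3 : c.1 (c.pt z) = z := c.1.right_inv h2
    rw [h1, h3]
    simp
  change fderiv ℝ (fun z => ρ (c.pt z) * c.1 (c.pt z) i) y (stdVec j) = _
  rw [he.fderiv_eq, ContinuousLinearMap.fderiv]
  simp [eq_comm]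

theorem schouten_eq_raise_iff_jacobi [T2Space M] (φ : DiffForm n M 3) (π : MultiVec n M 2) :
    (1 / 2 : ℝ) • schoutenBracket (ofMultiVec π) (ofMultiVec π) = ofMultiVec (raise π φ) ↔
      ∀ f g h : C^∞⟮𝓡 n, M; 𝓘(ℝ, ℝ), ℝ⟯, ∀ x : M,
        funBracket π (funBracket π f g) h x + funBracket π (funBracket π g h) f x +
          funBracket π (funBracket π h f) g x =
          φ.val x ![hamVec π f x, hamVec π g x, hamVec π h x] := by
  rw [schouten_eq_raise_iff]
  constructor
  · intro H f g h x
    obtain ⟨c, y, rfl⟩ := exists_chart_pt (n := n) x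
    rw [jacobi_apply, form_hamVec_apply, H c]
  · intro H c
    ext K y
    -- Functions whose differentials at the point are `dx^{K 0}`, `dx^{K 1}`, `dx^{K 2}` reduce both
    -- sums to their single term with index `K`.
    obtain ⟨f, hf⟩ := exists_partialDeriv_eq c y (K 0)
    obtain ⟨g, hg⟩ := exists_partialDeriv_eq c y (K 1)
    obtain ⟨h, hh⟩ := exists_partialDeriv_eq c y (K 2)
    have e := H f g h (c.pt y)
    rw [jacobi_apply, form_hamVec_apply, neg_inj] at e
    have single (a : (Fin 3 → Fin n) → ℝ) :
        ∑ L : Fin 3 → Fin n, a L * (if L 0 = K 0 then 1 else 0) * (if L 1 = K 1 then 1 else 0) *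
          (if L 2 = K 2 then 1 else 0) = a K := by
      rw [Finset.sum_eq_single K]
      · simp
      · intro L _ hL
        by_contra hne
        apply hL
        ext1 m
        fin_cases m
        · by_contra h0; exact hne (by simp [show L 0 ≠ K 0 from h0])
        · by_contra h0; exact hne (by simp [show L 1 ≠ K 1 from h0])
        · by_contra h0; exact hne (by simp [show L 2 ≠ K 2 from h0])
      · simp
    simp only [hf, hg, hh, single] at e
    exact e

end Functions

end

end TwistedPoisson

theorem mainTheorem3 {n : ℕ} {M : Type*} [TopologicalSpace M] [T2Space M]
    [ChartedSpace (TwistedPoisson.Eucl n) M] [IsManifold (𝓡 n) ∞ M] :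
    (∀ φ : TwistedPoisson.DiffForm n M 3,
      TwistedPoisson.StructureEq (TwistedPoisson.hd n M + TwistedPoisson.ofForm φ) ↔
        φ.IsClosed) ∧
    (∀ (φ : TwistedPoisson.DiffForm n M 3) (π : TwistedPoisson.MultiVec n M 2), φ.IsClosed →
      (TwistedPoisson.IsQuasiLieBialgebroid
          (TwistedPoisson.twist π (TwistedPoisson.hd n M + TwistedPoisson.ofForm φ)) ↔
        (1 / 2 : ℝ) • TwistedPoisson.schoutenBracket (TwistedPoisson.ofMultiVec π)
            (TwistedPoisson.ofMultiVec π) =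
          TwistedPoisson.ofMultiVec (TwistedPoisson.raise π φ))) ∧
    (∀ (π : TwistedPoisson.MultiVec n M 2) (f g : C^∞⟮𝓡 n, M; 𝓘(ℝ, ℝ), ℝ⟯),
      ∃ h : C^∞⟮𝓡 n, M; 𝓘(ℝ, ℝ), ℝ⟯,
        (∀ x, h x = TwistedPoisson.funBracket π f g x) ∧
        TwistedPoisson.ofFun h =
          TwistedPoisson.schoutenBracket
            (TwistedPoisson.schoutenBracket (TwistedPoisson.ofFun f) (TwistedPoisson.ofMultiVec π))
            (TwistedPoisson.ofFun g)) ∧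
    (∀ (φ : TwistedPoisson.DiffForm n M 3) (π : TwistedPoisson.MultiVec n M 2),
      (1 / 2 : ℝ) • TwistedPoisson.schoutenBracket (TwistedPoisson.ofMultiVec π)
            (TwistedPoisson.ofMultiVec π) =
          TwistedPoisson.ofMultiVec (TwistedPoisson.raise π φ) ↔
        ∀ f g h : C^∞⟮𝓡 n, M; 𝓘(ℝ, ℝ), ℝ⟯, ∀ x : M,
          TwistedPoisson.funBracket π (TwistedPoisson.funBracket π f g) h x +
          TwistedPoisson.funBracket π (TwistedPoisson.funBracket π g h) f x +
          TwistedPoisson.funBracket π (TwistedPoisson.funBracket π h f) g x =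
            φ.val x ![TwistedPoisson.hamVec π f x, TwistedPoisson.hamVec π g x,
              TwistedPoisson.hamVec π h x]) := by
  refine ⟨TwistedPoisson.structureEq_iff, fun φ π hφ =>
    TwistedPoisson.isQuasiLieBialgebroid_iff φ π hφ, fun π f g => ?_,
    TwistedPoisson.schouten_eq_raise_iff_jacobi⟩
  exact ⟨TwistedPoisson.smoothBracket π f g, fun x => rfl,
    TwistedPoisson.ofFun_smoothBracket π f g⟩
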